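/- Let $d\ge 2$ be an integer and $[d]=\{1,\dots,d\}$. Consider a Bell scenario in which Alice receives $x=(x_1,x_2)\in[d]^2$ and outputs $a\in\{1,2,\perp\}$, and Bob receives $y\in\{1,2\}$ and outputs $b\in[d]$. A quantum realisation consists of Hilbert spaces $H_A,H_B$ (not necessarily finite-dimensional), a (possibly mixed) state $\rho$ on $H_A\otimes H_B$, POVMs $\{A_x^a\}_a$ on $H_A$ for each $x$, and two POVMs $\{P_b\}_{b=1}^d$ (for $y=1$) and $\{Q_b\}_{b=1}^d$ (for $y=2$) on $H_B$; it produces the probabilities $p(a,b|x,y)=\mathrm{Tr}[\rho\,(A_x^a\otimes B_y^b)]$, where $B_1^b=P_b$ and $B_2^b=Q_b$, and $p(a|x)=\mathrm{Tr}[\rho\,(A_x^a\otimes 1)]$. With $\bar 1=2$, $\bar 2=1$, the Bell functional is $$\mathcal S_d^{\mathrm{MUB}}=\sum_{x,y}\bigl[p(a=y,b=x_y|x,y)-p(a=\bar y,b=x_y|x,y)\bigr]-\frac12\sqrt{\frac{d-1}{d}}\sum_x\bigl[p(a=1|x)+p(a=2|x)\bigr].$$ Theorem. Suppose that a quantum realisation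 attains the maximum of $\mathcal S_d^{\mathrm{MUB}}$ over all quantum realisations. Then: (i) There exist isometries $V_A:H_A\to\mathbb C^d\otimes H_A$ and $V_B:H_B\to\mathbb C^d\otimes H_B$ and a state $\rho_{\mathrm{aux}}$ on $H_A\otimes H_B$ such that $$(V_A\otimes V_B)\,\rho\,(V_A\otimes V_B)^\dagger=|\Phi_d\rangle\langle\Phi_d|\otimes\rho_{\mathrm{aux}},\qquad |\Phi_d\rangle=\frac1{\sqrt d}\sum_{k=1}^d|k\rangle\otimes|k\rangle,$$ where on the right-hand side one half of the maximally entangled state $|\Phi_d\rangle$ is held by Alice and the other half by Bob. (ii) If Bob's marginal state $\rho_B=\mathrm{Tr}_A\,\rho$ has full rank (its range is dense in $H_B$), then both measurements of Bob are projective and $$P_a=d\,P_aQ_bP_a\qquad\text{and}\qquad Q_b=d\,Q_bP_aQ_b\qquad\text{for all }a,b\in[d].$$ -/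

import Mathlib

open scoped TensorProduct InnerProductSpace

universe u v

noncomputable section

namespace MUBBell

/-! ### Hilbert space tensor products -/

/-- The Hilbert space tensor product `H ⊗ K`: the completion of the algebraic tensor product in the
inner product `⟪a ⊗ b, a' ⊗ b'⟫ = ⟪a, a'⟫ ⟪b, b'⟫`. -/
abbrev HTensor (H : Type*) (K : Type*) [NormedAddCommGroup H] [InnerProductSpace ℂ H]
    [NormedAddCommGroup K] [InnerProductSpace ℂ K] : Type _ :=
  UniformSpace.Completion (H ⊗[ℂ] K)

section TensorOps

variable {H H' K K' : Type*}
  [NormedAddCommGroup H] [InnerProductSpace ℂ H] [NormedAddCommGroup H'] [InnerProductSpace ℂ H']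
  [NormedAddCommGroup K] [InnerProductSpace ℂ K] [NormedAddCommGroup K'] [InnerProductSpace ℂ K']

/-- The bounded operator `w ↦ v ⊗ w` from `K` to `H ⊗ K`. -/
def tensorLeft (v : H) : K →L[ℂ] HTensor H K :=
  UniformSpace.Completion.toComplL ∘L TensorProduct.mkL ℂ H K v

/-- The tensor product `S ⊗ T` of two bounded operators, extended to the completions. -/
def opTensor (S : H →L[ℂ] H') (T : K →L[ℂ] K') : HTensor H K →L[ℂ] HTensor H' K' :=
  (TensorProduct.mapL S T).completion

theorem opTensor_tensorLeft (S : H →L[ℂ] H') (T : K →L[ℂ] K') (a : H) (b : K) :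
    opTensor S T (tensorLeft a b) = tensorLeft (S a) (T b) := by
  simp [opTensor, tensorLeft]

end TensorOps

/-! ### Trace and density operators -/

section Trace

variable (H : Type*) [NormedAddCommGroup H] [InnerProductSpace ℂ H] [CompleteSpace H]

/-- Index set of a fixed Hilbert basis of `H`. -/
def basisIndex : Set H := (exists_hilbertBasis ℂ H).choose

/-- A fixed Hilbert basis of `H`. -/
def basis : HilbertBasis (basisIndex H) ℂ H := (exists_hilbertBasis ℂ H).choose_spec.choose

variable {H}

/-- The trace `∑ i, ⟪e i, T (e i)⟫`. It is used only for operators `ρ * X` with `ρ` a density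
operator and `X` bounded; there the sum converges absolutely and does not depend on the basis. -/
def trace (T : H →L[ℂ] H) : ℂ := ∑' i, ⟪basis H i, T (basis H i)⟫_ℂ

/-- Density operators (quantum states): positive operators of trace one. -/
structure IsDensityOperator (ρ : H →L[ℂ] H) : Prop where
  isPositive : ρ.IsPositive
  hasSum_trace : HasSum (fun i => ⟪basis H i, ρ (basis H i)⟫_ℂ) 1

/-- A density operator has full rank if its support, the closure of its range, is the whole space;
in finite dimension this says that its rank is the dimension. -/
def FullRank (ρ : H →L[ℂ] H) : Prop := DenseRange ρ

end Trace

section PartialTrace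

variable {HA HB : Type*}
  [NormedAddCommGroup HA] [InnerProductSpace ℂ HA] [CompleteSpace HA]
  [NormedAddCommGroup HB] [InnerProductSpace ℂ HB] [CompleteSpace HB]

/-- Bob's marginal state: the partial trace `∑ i, (⟨e i| ⊗ 1) ρ (|e i⟩ ⊗ 1)` over Alice's system.
For a density operator the series converges absolutely in operator norm. -/
def marginalBob (ρ : HTensor HA HB →L[ℂ] HTensor HA HB) : HB →L[ℂ] HB :=
  ∑' i, (tensorLeft (K := HB) (basis HA i)).adjoint ∘L ρ ∘L tensorLeft (K := HB) (basis HA i)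

end PartialTrace

/-! ### Measurements -/

/-- A measurement (POVM) with outcomes in `ι`. -/
structure POVM (ι : Type*) [Fintype ι] (H : Type*) [NormedAddCommGroup H] [InnerProductSpace ℂ H]
    [CompleteSpace H] where
  effect : ι → H →L[ℂ] H
  isPositive : ∀ i, (effect i).IsPositive
  sum_effect : ∑ i, effect i = 1

/-- A measurement is projective if all its measurement operators are orthogonal projections. -/
def POVM.IsProjective {ι : Type*} [Fintype ι] {H : Type*} [NormedAddCommGroup H]
    [InnerProductSpace ℂ H] [CompleteSpace H] (M : POVM ι H) : Prop :=
  ∀ i, IsStarProjection (M.effect i)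

/-! ### The Bell scenario -/

section Bell

/-- A quantum realisation of the scenario, with a possibly mixed shared state. Alice's inputs are
the pairs `x = x₁x₂`, as functions `x : Fin 2 → Fin d`; her outcomes are `some 0`, `some 1`
(for `1` and `2`) and `none` (for `⊥`). Bob's input is `y : Fin 2`, his outcome `b : Fin d`. -/
structure Realisation (d : ℕ) (HA : Type*) (HB : Type*)
    [NormedAddCommGroup HA] [InnerProductSpace ℂ HA] [CompleteSpace HA]
    [NormedAddCommGroup HB] [InnerProductSpace ℂ HB] [CompleteSpace HB] where
  state : HTensor HA HB →L[ℂ] HTensor HA HB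
  isDensity : IsDensityOperator state
  alice : (Fin 2 → Fin d) → POVM (Option (Fin 2)) HA
  bob : Fin 2 → POVM (Fin d) HB

namespace Realisation

variable {d : ℕ} {HA HB : Type*}
  [NormedAddCommGroup HA] [InnerProductSpace ℂ HA] [CompleteSpace HA]
  [NormedAddCommGroup HB] [InnerProductSpace ℂ HB] [CompleteSpace HB]
  (R : Realisation d HA HB)

/-- The probability `p(a,b|x,y) = Tr (ρ (A_x^a ⊗ B_y^b))`. -/
def prob (a : Option (Fin 2)) (b : Fin d) (x : Fin 2 → Fin d) (y : Fin 2) : ℝ :=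
  (trace (R.state * opTensor ((R.alice x).effect a) ((R.bob y).effect b))).re

/-- Alice's marginal probability `p(a|x) = Tr (ρ (A_x^a ⊗ 1))`. -/
def probAlice (a : Option (Fin 2)) (x : Fin 2 → Fin d) : ℝ :=
  (trace (R.state * opTensor ((R.alice x).effect a) (1 : HB →L[ℂ] HB))).re

/-- The score: a point is won if `a = y` and `b = x_y`, and lost if `a` is the other element
`Fin.rev y` of `{1, 2}` and `b = x_y`. -/
def score : ℝ :=
  ∑ x : Fin 2 → Fin d, ∑ y : Fin 2,
    (R.prob (some y) (x y) x y - R.prob (some (Fin.rev y)) (x y) x y)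

/-- The Bell functional: the score, minus the penalty `γ_d = (1/2) √((d-1)/d)` whenever Alice does
not output `⊥`. -/
def bellValue : ℝ :=
  R.score - (1 / 2) * √(((d : ℝ) - 1) / d) *
    ∑ x : Fin 2 → Fin d, (R.probAlice (some 0) x + R.probAlice (some 1) x)

end Realisation

/-- All values of the Bell functional in quantum theory, over all shared states and measurements on
arbitrary Hilbert spaces. -/
def quantumValues (d : ℕ) : Set ℝ :=
  {s | ∃ (HA : Type u) (HB : Type v)
      (_ : NormedAddCommGroup HA) (_ : InnerProductSpace ℂ HA) (_ : CompleteSpace HA)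
      (_ : NormedAddCommGroup HB) (_ : InnerProductSpace ℂ HB) (_ : CompleteSpace HB)
      (R : Realisation d HA HB), s = R.bellValue}

end Bell

/-! ### The maximally entangled state -/

section MaxEnt

variable (d : ℕ) (HA HB : Type*)
  [NormedAddCommGroup HA] [InnerProductSpace ℂ HA]
  [NormedAddCommGroup HB] [InnerProductSpace ℂ HB]

/-- The operator `ψ ↦ Φ ⊗ ψ`, where `Φ = (1/√d) ∑ k, |k⟩ ⊗ |k⟩` is the maximally entangled state of
local dimension `d`, with the tensor factors of `Φ ⊗ ψ` in the order
`(ℂ^d ⊗ HA) ⊗ (ℂ^d ⊗ HB)`, i.e. with one half of `Φ` on each side. -/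
def adjoinMaxEnt : HTensor HA HB →L[ℂ]
    HTensor (HTensor (EuclideanSpace ℂ (Fin d)) HA) (HTensor (EuclideanSpace ℂ (Fin d)) HB) :=
  ((1 / √(d : ℝ) : ℝ) : ℂ) • ∑ k : Fin d,
    opTensor (tensorLeft (K := HA) (EuclideanSpace.single k (1 : ℂ)))
      (tensorLeft (K := HB) (EuclideanSpace.single k (1 : ℂ)))

theorem adjoinMaxEnt_tensorLeft (a : HA) (b : HB) :
    adjoinMaxEnt d HA HB (tensorLeft a b) = ((1 / √(d : ℝ) : ℝ) : ℂ) • ∑ k : Fin d,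
      tensorLeft (tensorLeft (EuclideanSpace.single k (1 : ℂ)) a)
        (tensorLeft (EuclideanSpace.single k (1 : ℂ)) b) := by
  simp [adjoinMaxEnt, opTensor_tensorLeft]

end MaxEnt

end MUBBell

end

/-!
Write `P`, `Q` for Bob's measurements, `Z = A₁ - A₂` and `S = A₁ + A₂` for the difference and the sum of
Alice's conclusive effects on input `(j, k)`, and `t = √((d-1)/d)`. The Bell operator is bounded by
`(d-1)/t = √(d(d-1))`, because the difference is a sum of positive operators:

`(d-1)/t - 𝓑 = ∑ⱼₖ ((t/2) (S - Z²) + (1/2t) (t Z - (Pⱼ - Qₖ))²) + (d/2t) (∑ⱼ (Pⱼ - Pⱼ²) + ∑ₖ (Qₖ - Qₖ²))`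

(`bellOperator_sumOfSquares`, `Realisation.bound_sub_bellValue`), where `S - Z² ≥ Z A_⊥ Z ≥ 0`. The bound is
attained by a maximally entangled state measured in the computational and the Fourier basis
(`exists_optimal_realisation`), so an optimal realisation makes every term vanish on its state. All
such relations are expressed as `X σ = 0`, where `σ` is the square root of the state `ρ`; trace class
theory is reduced to the identity `tr (ρ X) = tr (σ X σ)`
(`IsDensityOperator.hasSum_trace_mul`).

On the state, `Pⱼ` and `Qₖ` are therefore idempotent, `t Z` acts like `Pⱼ - Qₖ`, and `Z³` like `Z`.
Since Alice's operators commute with Bob's, `(Pⱼ - Qₖ)³` acts like `t² (Pⱼ - Qₖ)`. Linear combinations of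
the `Z` act on the state like `Pⱼ` and `Qₖ`, so Alice has measurements with the same relations
(`Realisation.aliceCopy`). The relations become operator identities after restriction to the local
supports of the state (`exists_supportProjection`, `isMUBOn_support`). There, expanding the cube and
summing over one index gives `P = d P Q P` and `Q = d Q P Q` (`smul_mul_mul_eq_of_pow_three`). If Bob's
marginal has full rank, his support is everything, which is the second claim.

For the first claim each party applies `v ↦ ∑ₖ |k⟩ ⊗ √d Q₀ Pₖ v` on the support, extended to an isometry
of the whole space (`extraction`). Moving Alice's operators over to Bob, in reverse order, the component
at `|j⟩ ⊗ |k⟩` becomes `d Q₀ Pₖ Pⱼ Q₀`, which is `Q₀` for `j = k` and `0` otherwise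
(`opTensor_extraction_mul`). Hence `σ` is mapped to `Φ ⊗ √d Q₀ σ`.
-/

noncomputable section

namespace MUBBell

/-! ### Operators on Hilbert space tensor products -/

section OpTensor

variable {H H' H'' K K' K'' : Type*}
  [NormedAddCommGroup H] [InnerProductSpace ℂ H] [NormedAddCommGroup H'] [InnerProductSpace ℂ H']
  [NormedAddCommGroup H''] [InnerProductSpace ℂ H'']
  [NormedAddCommGroup K] [InnerProductSpace ℂ K] [NormedAddCommGroup K'] [InnerProductSpace ℂ K']
  [NormedAddCommGroup K''] [InnerProductSpace ℂ K'']

theorem inner_tensorLeft (a a' : H) (b b' : K) :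
    ⟪tensorLeft a b, tensorLeft a' b'⟫_ℂ = ⟪a, a'⟫_ℂ * ⟪b, b'⟫_ℂ := by
  simp [tensorLeft, UniformSpace.Completion.inner_coe]

theorem tensorLeft_add (a a' : H) (b : K) :
    tensorLeft (a + a') b = tensorLeft a b + tensorLeft a' b := by
  simp [tensorLeft]

theorem tensorLeft_smul (c : ℂ) (a : H) (b : K) :
    tensorLeft (c • a) b = c • tensorLeft a b := by
  simp [tensorLeft]

/-- Product vectors are total: bounded operators that agree on them are equal. -/
theorem ext_tensorLeft {E : Type*} [NormedAddCommGroup E] [NormedSpace ℂ E]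
    {S T : HTensor H K →L[ℂ] E} (h : ∀ a b, S (tensorLeft a b) = T (tensorLeft a b)) : S = T := by
  ext x
  induction x using UniformSpace.Completion.induction_on with
  | hp => exact isClosed_eq S.continuous T.continuous
  | ih x =>
    induction x using TensorProduct.induction_on with
    | zero => rw [UniformSpace.Completion.coe_zero, map_zero, map_zero]
    | tmul a b => exact h a b
    | add x y hx hy => simp [UniformSpace.Completion.coe_add, hx, hy]

/-- A vector orthogonal to all product vectors vanishes. -/
theorem eq_zero_of_inner_tensorLeft {x : HTensor H K}
    (h : ∀ a b, ⟪tensorLeft a b, x⟫_ℂ = 0) : x = 0 := by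
  have : innerSL ℂ x = 0 := ext_tensorLeft fun a b => by
    simpa using (inner_eq_zero_symm).1 (h a b)
  have h2 : ⟪x, x⟫_ℂ = 0 := by simpa using congrArg (fun f => f x) this
  exact inner_self_eq_zero.1 h2

theorem opTensor_comp (S' : H' →L[ℂ] H'') (S : H →L[ℂ] H') (T' : K' →L[ℂ] K'')
    (T : K →L[ℂ] K') : opTensor S' T' ∘L opTensor S T = opTensor (S' ∘L S) (T' ∘L T) :=
  ext_tensorLeft fun a b => by simp [opTensor_tensorLeft]

theorem opTensor_one_one : opTensor (1 : H →L[ℂ] H) (1 : K →L[ℂ] K) = 1 :=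
  ext_tensorLeft fun a b => by simp [opTensor_tensorLeft]

theorem opTensor_add_left (S S' : H →L[ℂ] H') (T : K →L[ℂ] K') :
    opTensor (S + S') T = opTensor S T + opTensor S' T :=
  ext_tensorLeft fun a b => by simp [opTensor_tensorLeft, tensorLeft_add]

theorem opTensor_add_right (S : H →L[ℂ] H') (T T' : K →L[ℂ] K') :
    opTensor S (T + T') = opTensor S T + opTensor S T' :=
  ext_tensorLeft fun a b => by simp [opTensor_tensorLeft]

theorem opTensor_smul_left (c : ℂ) (S : H →L[ℂ] H') (T : K →L[ℂ] K') :
    opTensor (c • S) T = c • opTensor S T :=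
  ext_tensorLeft fun a b => by simp [opTensor_tensorLeft, tensorLeft_smul]

theorem opTensor_smul_right (c : ℂ) (S : H →L[ℂ] H') (T : K →L[ℂ] K') :
    opTensor S (c • T) = c • opTensor S T :=
  ext_tensorLeft fun a b => by simp [opTensor_tensorLeft]

theorem opTensor_zero_left (T : K →L[ℂ] K') : opTensor (0 : H →L[ℂ] H') T = 0 := by
  simpa using opTensor_smul_left 0 (0 : H →L[ℂ] H') T

theorem opTensor_zero_right (S : H →L[ℂ] H') : opTensor S (0 : K →L[ℂ] K') = 0 := by
  simpa using opTensor_smul_right 0 S (0 : K →L[ℂ] K')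

theorem opTensor_sum_left {ι : Type*} (s : Finset ι) (S : ι → H →L[ℂ] H') (T : K →L[ℂ] K') :
    opTensor (∑ i ∈ s, S i) T = ∑ i ∈ s, opTensor (S i) T := by
  classical
  induction s using Finset.induction_on with
  | empty => simp [opTensor_zero_left]
  | insert i s hi ih => simp [Finset.sum_insert hi, opTensor_add_left, ih]

theorem opTensor_sum_right {ι : Type*} (s : Finset ι) (S : H →L[ℂ] H') (T : ι → K →L[ℂ] K') :
    opTensor S (∑ i ∈ s, T i) = ∑ i ∈ s, opTensor S (T i) := by
  classical
  induction s using Finset.induction_on with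
  | empty => simp [opTensor_zero_right]
  | insert i s hi ih => simp [Finset.sum_insert hi, opTensor_add_right, ih]

section Complete

variable [CompleteSpace K]

theorem adjoint_tensorLeft_comp (v w : H) :
    (tensorLeft (K := K) v).adjoint ∘L tensorLeft w = ⟪v, w⟫_ℂ • (1 : K →L[ℂ] K) := by
  ext b
  refine ext_inner_left ℂ fun b' => ?_
  simp [ContinuousLinearMap.adjoint_inner_right, inner_tensorLeft, inner_smul_right]
variable [CompleteSpace H] [CompleteSpace H'] [CompleteSpace K']

theorem adjoint_opTensor (S : H →L[ℂ] H') (T : K →L[ℂ] K') :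
    (opTensor S T).adjoint = opTensor S.adjoint T.adjoint := by
  refine ext_tensorLeft fun a b => ?_
  rw [← sub_eq_zero]
  refine eq_zero_of_inner_tensorLeft fun a' b' => ?_
  rw [inner_sub_right, ContinuousLinearMap.adjoint_inner_right, opTensor_tensorLeft,
    opTensor_tensorLeft, inner_tensorLeft, inner_tensorLeft,
    ContinuousLinearMap.adjoint_inner_right, ContinuousLinearMap.adjoint_inner_right, sub_self]

variable (H K) in
/-- Alice's operators `S ↦ S ⊗ 1` on the joint system. -/
def aliceHom : (H →L[ℂ] H) →⋆ₐ[ℂ] (HTensor H K →L[ℂ] HTensor H K) where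
  toFun S := opTensor S 1
  map_one' := opTensor_one_one
  map_mul' S T := by
    rw [ContinuousLinearMap.mul_def, ContinuousLinearMap.mul_def, opTensor_comp]; rfl
  map_zero' := opTensor_zero_left _
  map_add' S T := opTensor_add_left S T _
  commutes' c := by
    rw [Algebra.algebraMap_eq_smul_one, Algebra.algebraMap_eq_smul_one, opTensor_smul_left,
      opTensor_one_one]
  map_star' S := by
    rw [ContinuousLinearMap.star_eq_adjoint, ContinuousLinearMap.star_eq_adjoint, adjoint_opTensor]
    congr 1
    rw [← ContinuousLinearMap.star_eq_adjoint, star_one]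

variable (H K) in
/-- Bob's operators `T ↦ 1 ⊗ T` on the joint system. -/
def bobHom : (K →L[ℂ] K) →⋆ₐ[ℂ] (HTensor H K →L[ℂ] HTensor H K) where
  toFun T := opTensor 1 T
  map_one' := opTensor_one_one
  map_mul' S T := by
    rw [ContinuousLinearMap.mul_def, ContinuousLinearMap.mul_def, opTensor_comp]; rfl
  map_zero' := opTensor_zero_right _
  map_add' S T := opTensor_add_right _ S T
  commutes' c := by
    rw [Algebra.algebraMap_eq_smul_one, Algebra.algebraMap_eq_smul_one, opTensor_smul_right,
      opTensor_one_one]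
  map_star' S := by
    rw [ContinuousLinearMap.star_eq_adjoint, ContinuousLinearMap.star_eq_adjoint, adjoint_opTensor]
    congr 1
    rw [← ContinuousLinearMap.star_eq_adjoint, star_one]

theorem aliceHom_apply (S : H →L[ℂ] H) : aliceHom H K S = opTensor S 1 := rfl

theorem bobHom_apply (T : K →L[ℂ] K) : bobHom H K T = opTensor 1 T := rfl

theorem aliceHom_mul_bobHom (S : H →L[ℂ] H) (T : K →L[ℂ] K) :
    aliceHom H K S * bobHom H K T = opTensor S T := by
  rw [aliceHom_apply, bobHom_apply, ContinuousLinearMap.mul_def, opTensor_comp]; rfl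

theorem aliceHom_commute_bobHom (S : H →L[ℂ] H) (T : K →L[ℂ] K) :
    Commute (aliceHom H K S) (bobHom H K T) := by
  rw [Commute, SemiconjBy, aliceHom_mul_bobHom, aliceHom_apply, bobHom_apply,
    ContinuousLinearMap.mul_def, opTensor_comp]
  rfl

end Complete

end OpTensor

/-! ### Hilbert–Schmidt sums and expectation values -/

section HilbertSchmidt

variable {H : Type*} [NormedAddCommGroup H] [InnerProductSpace ℂ H]
  {ι : Type*} (e : HilbertBasis ι ℂ H)

theorem hasSum_norm_sq_inner (x : H) : HasSum (fun j => ‖⟪e j, x⟫_ℂ‖ ^ 2) (‖x‖ ^ 2) := by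
  have h := Complex.hasSum_re (e.hasSum_inner_mul_inner x x)
  convert h using 2 with j
  · rw [← inner_conj_symm x (e j), ← Complex.normSq_eq_conj_mul_self, Complex.ofReal_re,
      Complex.normSq_eq_norm_sq]
  · rw [inner_self_eq_norm_sq_to_K]; norm_cast

theorem summable_norm_sq_add {A B : H →L[ℂ] H} (hA : Summable fun i => ‖A (e i)‖ ^ 2)
    (hB : Summable fun i => ‖B (e i)‖ ^ 2) : Summable fun i => ‖(A + B) (e i)‖ ^ 2 := by
  refine Summable.of_nonneg_of_le (fun i => by positivity) (fun i => ?_)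
    ((hA.mul_left 2).add (hB.mul_left 2))
  have h := norm_add_le (A (e i)) (B (e i))
  rw [add_apply]
  nlinarith [norm_nonneg (A (e i) + B (e i)), sq_nonneg (‖A (e i)‖ - ‖B (e i)‖)]

theorem summable_norm_sq_smul {A : H →L[ℂ] H} (c : ℂ) (hA : Summable fun i => ‖A (e i)‖ ^ 2) :
    Summable fun i => ‖(c • A) (e i)‖ ^ 2 := by
  simpa [norm_smul, mul_pow] using hA.mul_left (‖c‖ ^ 2)

variable [CompleteSpace H]

/-- The Hilbert–Schmidt norm of an operator equals that of its adjoint. -/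
theorem hasSum_norm_sq_adjoint {T : H →L[ℂ] H} {s : ℝ} (h : HasSum (fun i => ‖T (e i)‖ ^ 2) s) :
    HasSum (fun j => ‖T.adjoint (e j)‖ ^ 2) s := by
  set F : ι × ι → ℝ := fun p => ‖⟪e p.2, T (e p.1)⟫_ℂ‖ ^ 2 with hF
  have hrow : ∀ i, HasSum (fun j => F (i, j)) (‖T (e i)‖ ^ 2) := fun i =>
    hasSum_norm_sq_inner e (T (e i))
  have hsum : Summable F := by
    refine (summable_prod_of_nonneg fun p => by positivity).2 ⟨fun i => (hrow i).summable, ?_⟩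
    exact h.summable.congr fun i => (hrow i).tsum_eq.symm
  have h1 := hsum.hasSum.prod_fiberwise hrow
  have h2 : HasSum (fun p : ι × ι => F p.swap) (∑' p, F p) :=
    (Equiv.prodComm ι ι).hasSum_iff.2 hsum.hasSum
  rw [h.unique h1]
  refine h2.prod_fiberwise fun j => ?_
  convert hasSum_norm_sq_inner e (T.adjoint (e j)) using 2 with i
  simp only [hF, Prod.swap_prod_mk]
  rw [ContinuousLinearMap.adjoint_inner_right, norm_inner_symm]

/-- Cyclicity of the trace for two Hilbert–Schmidt operators: `tr (A* B) = tr (B A*)`, obtained by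
polarisation from the invariance of the Hilbert–Schmidt norm under the adjoint. -/
theorem exists_hasSum_inner_adjoint {A B : H →L[ℂ] H} (hA : Summable fun i => ‖A (e i)‖ ^ 2)
    (hB : Summable fun i => ‖B (e i)‖ ^ 2) :
    ∃ s : ℂ, HasSum (fun i => ⟪A (e i), B (e i)⟫_ℂ) s ∧
      HasSum (fun i => ⟪B.adjoint (e i), A.adjoint (e i)⟫_ℂ) s := by
  have key : ∀ c : ℂ, ∃ s : ℝ, HasSum (fun i => ‖A (e i) + c • B (e i)‖ ^ 2) s ∧
      HasSum (fun i => ‖A.adjoint (e i) + (starRingEnd ℂ c) • B.adjoint (e i)‖ ^ 2) s := by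
    intro c
    obtain ⟨s, hs⟩ := summable_norm_sq_add e hA (summable_norm_sq_smul e c hB)
    refine ⟨s, by simpa using hs, ?_⟩
    have := hasSum_norm_sq_adjoint e hs
    rw [map_add, map_smulₛₗ] at this
    simpa using this
  obtain ⟨s1, h1, h1'⟩ := key 1
  obtain ⟨s2, h2, h2'⟩ := key (-1)
  obtain ⟨s3, h3, h3'⟩ := key (-Complex.I)
  obtain ⟨s4, h4, h4'⟩ := key Complex.I
  refine ⟨((s1 : ℂ) - s2 + (s3 - s4) * Complex.I) / 4, ?_, ?_⟩
  · have := (((Complex.hasSum_ofReal.2 h1).sub (Complex.hasSum_ofReal.2 h2)).add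
      (((Complex.hasSum_ofReal.2 h3).sub (Complex.hasSum_ofReal.2 h4)).mul_right Complex.I)).div_const 4
    refine Eq.mp (congrArg (HasSum · _) (funext fun i => ?_)) this
    rw [inner_eq_sum_norm_sq_div_four (𝕜 := ℂ)]
    simp [sub_eq_add_neg]
  · have := (((Complex.hasSum_ofReal.2 h1').sub (Complex.hasSum_ofReal.2 h2')).add
      (((Complex.hasSum_ofReal.2 h3').sub (Complex.hasSum_ofReal.2 h4')).mul_right Complex.I)).div_const 4
    refine Eq.mp (congrArg (HasSum · _) (funext fun i => ?_)) this
    rw [inner_eq_sum_norm_sq_div_four (𝕜 := ℂ)]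
    have e1 : ∀ x y : H, ‖x - Complex.I • y‖ = ‖y + Complex.I • x‖ := by
      intro x y
      have : x - Complex.I • y = (-Complex.I) • (y + Complex.I • x) := by
        rw [smul_add, smul_smul]; simp [sub_eq_add_neg, add_comm]
      rw [this, norm_smul]; simp
    have e2 : ∀ x y : H, ‖x + Complex.I • y‖ = ‖y - Complex.I • x‖ := fun x y => (e1 y x).symm
    have e3 := norm_sub_rev (B.adjoint (e i)) (A.adjoint (e i))
    rw [RCLike.I_to_complex, e1 (B.adjoint (e i)) (A.adjoint (e i)), e2 (B.adjoint (e i)) (A.adjoint (e i)), e3,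
      add_comm (B.adjoint (e i)) (A.adjoint (e i))]
    simp [sub_eq_add_neg]

end HilbertSchmidt

section Expectation

variable {H : Type*} [NormedAddCommGroup H] [InnerProductSpace ℂ H] [CompleteSpace H]
  {ρ : H →L[ℂ] H}

/-- A self-adjoint square root of a state. -/
def IsDensityOperator.root (_ : IsDensityOperator ρ) : H →L[ℂ] H := CFC.sqrt ρ

theorem IsDensityOperator.adjoint_root (hρ : IsDensityOperator ρ) : hρ.root.adjoint = hρ.root :=
  (IsSelfAdjoint.of_nonneg (CFC.sqrt_nonneg ρ)).star_eq

theorem IsDensityOperator.root_mul_root (hρ : IsDensityOperator ρ) : hρ.root * hρ.root = ρ :=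
  CFC.sqrt_mul_sqrt_self ρ ((ContinuousLinearMap.nonneg_iff_isPositive _).2 hρ.isPositive)

theorem IsDensityOperator.root_apply_root (hρ : IsDensityOperator ρ) (x : H) :
    hρ.root (hρ.root x) = ρ x := by
  conv_rhs => rw [← hρ.root_mul_root]
  rfl

theorem IsDensityOperator.hasSum_norm_sq_root (hρ : IsDensityOperator ρ) :
    HasSum (fun i => ‖hρ.root (basis H i)‖ ^ 2) 1 := by
  have h := Complex.hasSum_re hρ.hasSum_trace
  rw [Complex.one_re] at h
  convert h using 2 with i
  rw [← hρ.root_apply_root, ← ContinuousLinearMap.adjoint_inner_left, hρ.adjoint_root, inner_self_eq_norm_sq_to_K]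
  norm_cast

/-- `tr (ρ X) = tr (σ X σ)` for the square root `σ` of the state `ρ`. -/
theorem IsDensityOperator.hasSum_trace_mul (hρ : IsDensityOperator ρ) (X : H →L[ℂ] H) :
    HasSum (fun i => ⟪hρ.root (basis H i), X (hρ.root (basis H i))⟫_ℂ) (trace (ρ * X)) := by
  have h1 := hρ.hasSum_norm_sq_root.summable
  have h2 : Summable fun i => ‖(X.adjoint * hρ.root) (basis H i)‖ ^ 2 := by
    refine Summable.of_nonneg_of_le (fun i => by positivity) (fun i => ?_)
      (h1.mul_left (‖X.adjoint‖ ^ 2))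
    rw [← mul_pow]
    gcongr
    exact X.adjoint.le_opNorm _
  have h3 : Summable fun i => ‖(hρ.root * X) (basis H i)‖ ^ 2 := by
    obtain ⟨s, hs⟩ := h2
    have := hasSum_norm_sq_adjoint _ hs
    rw [ContinuousLinearMap.mul_def, ContinuousLinearMap.adjoint_comp, hρ.adjoint_root,
      ContinuousLinearMap.adjoint_adjoint] at this
    exact this.summable
  obtain ⟨s, hs, hs'⟩ := exists_hasSum_inner_adjoint _ h1 h3
  have e1 : trace (ρ * X) = s := by
    refine (HasSum.tsum_eq ?_)
    convert hs using 2 with i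
    rw [mul_apply_eq_comp, mul_apply_eq_comp, ← hρ.root_apply_root,
      ← ContinuousLinearMap.adjoint_inner_left, hρ.adjoint_root]
  rw [e1]
  convert hs' using 2 with i
  rw [ContinuousLinearMap.mul_def, ContinuousLinearMap.adjoint_comp, hρ.adjoint_root,
    ContinuousLinearMap.comp_apply, ContinuousLinearMap.adjoint_inner_left]

/-- The expectation value `X ↦ tr (ρ X)` of a state, as a linear functional. -/
def IsDensityOperator.expect (hρ : IsDensityOperator ρ) : (H →L[ℂ] H) →ₗ[ℂ] ℂ where
  toFun X := trace (ρ * X)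
  map_add' X Y := by
    refine (hρ.hasSum_trace_mul (X + Y)).unique ?_
    simpa [inner_add_right] using (hρ.hasSum_trace_mul X).add (hρ.hasSum_trace_mul Y)
  map_smul' c X := by
    refine (hρ.hasSum_trace_mul (c • X)).unique ?_
    simpa [inner_smul_right] using (hρ.hasSum_trace_mul X).mul_left c

theorem IsDensityOperator.expect_apply (hρ : IsDensityOperator ρ) (X : H →L[ℂ] H) :
    hρ.expect X = trace (ρ * X) := rfl

theorem IsDensityOperator.expect_one (hρ : IsDensityOperator ρ) : hρ.expect 1 = 1 := by
  rw [hρ.expect_apply, mul_one]; exact hρ.hasSum_trace.tsum_eq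

theorem IsDensityOperator.expect_nonneg (hρ : IsDensityOperator ρ) {X : H →L[ℂ] H} (hX : 0 ≤ X) :
    0 ≤ (hρ.expect X).re :=
  (Complex.hasSum_re (hρ.hasSum_trace_mul X)).nonneg fun _ =>
    ((ContinuousLinearMap.nonneg_iff_isPositive _).1 hX).re_inner_nonneg_right _

theorem IsDensityOperator.expect_eq_zero_of_mul_eq_zero (hρ : IsDensityOperator ρ)
    {X : H →L[ℂ] H} (hX : X * ρ = 0) (hsa : IsSelfAdjoint X) : hρ.expect X = 0 := by
  have : ρ * X = 0 := by
    have h := congrArg star hX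
    rwa [star_mul, hsa.star_eq, star_zero, ContinuousLinearMap.star_eq_adjoint,
      hρ.isPositive.isSelfAdjoint.adjoint_eq] at h
  rw [hρ.expect_apply, this]
  simp [trace]

theorem eq_zero_of_apply_basis {E : Type*} [NormedAddCommGroup E] [NormedSpace ℂ E]
    {X : H →L[ℂ] E} (h : ∀ i, X (basis H i) = 0) : X = 0 := by
  refine ContinuousLinearMap.ext_on
    (Submodule.dense_iff_topologicalClosure_eq_top.2 (basis H).dense_span) ?_
  rintro _ ⟨i, rfl⟩
  simpa using h i

/-- If `Y* Y` has expectation zero, then `Y` annihilates the state. -/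
theorem IsDensityOperator.mul_root_eq_zero (hρ : IsDensityOperator ρ) {Y : H →L[ℂ] H}
    (h : (hρ.expect (star Y * Y)).re = 0) : Y * hρ.root = 0 := by
  have h1 := Complex.hasSum_re (hρ.hasSum_trace_mul (star Y * Y))
  rw [← hρ.expect_apply, h] at h1
  have h2 : ∀ i, (⟪hρ.root (basis H i),
      (star Y * Y) (hρ.root (basis H i))⟫_ℂ).re = ‖Y (hρ.root (basis H i))‖ ^ 2 := by
    intro i
    rw [mul_apply_eq_comp, ContinuousLinearMap.star_eq_adjoint,
      ContinuousLinearMap.adjoint_inner_right, inner_self_eq_norm_sq_to_K]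
    norm_cast
  simp only [h2] at h1
  have h3 := (hasSum_zero_iff_of_nonneg fun i => by positivity).1 h1
  refine eq_zero_of_apply_basis fun i => ?_
  simpa using congrFun h3 i

theorem IsDensityOperator.mul_root_eq_zero_of_nonneg (hρ : IsDensityOperator ρ)
    {X : H →L[ℂ] H} (hX : 0 ≤ X) (h : (hρ.expect X).re = 0) : X * hρ.root = 0 := by
  have h1 : star (CFC.sqrt X) * CFC.sqrt X = X := by
    rw [(IsSelfAdjoint.of_nonneg (CFC.sqrt_nonneg X)).star_eq, CFC.sqrt_mul_sqrt_self X hX]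
  have h2 := hρ.mul_root_eq_zero (Y := CFC.sqrt X) (by rwa [h1])
  rw [← h1, mul_assoc, h2, mul_zero]

theorem isSelfAdjoint_smul_sub_sub {X Y Z : H →L[ℂ] H} (c : ℝ) (hX : IsSelfAdjoint X)
    (hY : IsSelfAdjoint Y) (hZ : IsSelfAdjoint Z) : IsSelfAdjoint ((c : ℂ) • X - (Y - Z)) :=
  (IsSelfAdjoint.smul (Complex.conj_ofReal c) hX).sub (hY.sub hZ)

end Expectation

/-! ### Local supports of an operator on the joint system -/

section Support

/-- Let `R` embed the operators on `K` into those on a larger system, of which the embeddings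
`τ u : K → 𝓗` span a dense subspace. The projection onto the support in `K` of an operator `σ` is
the smallest projection `E` with `R E * σ = σ`; relations `R X * σ = 0` become `X * E = 0`. -/
theorem exists_supportProjection {𝓗 K U : Type*}
    [NormedAddCommGroup 𝓗] [InnerProductSpace ℂ 𝓗] [CompleteSpace 𝓗]
    [NormedAddCommGroup K] [InnerProductSpace ℂ K] [CompleteSpace K]
    (τ : U → K →L[ℂ] 𝓗) (hτ : ∀ x, (∀ u w, ⟪τ u w, x⟫_ℂ = 0) → x = 0)
    (R : (K →L[ℂ] K) →⋆ₐ[ℂ] (𝓗 →L[ℂ] 𝓗)) (hR : ∀ X u w, R X (τ u w) = τ u (X w))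
    (σ : 𝓗 →L[ℂ] 𝓗) :
    ∃ E : K →L[ℂ] K, IsStarProjection E ∧ R E * σ = σ ∧ ∀ X, R X * σ = 0 → X * E = 0 := by
  have hadj : ∀ X u y, (τ u).adjoint (R X y) = X ((τ u).adjoint y) := by
    intro X u y
    refine ext_inner_left ℂ fun w => ?_
    have h := ContinuousLinearMap.adjoint_inner_left (R X) y (τ u w)
    rw [← ContinuousLinearMap.star_eq_adjoint, ← map_star, hR] at h
    rw [ContinuousLinearMap.adjoint_inner_right, ← h, ContinuousLinearMap.star_eq_adjoint,
      ← ContinuousLinearMap.adjoint_inner_right (τ u), ContinuousLinearMap.adjoint_inner_left]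
  set S : Submodule ℂ K := Submodule.span ℂ {y | ∃ u x, (τ u).adjoint (σ x) = y} with hS
  set C := S.topologicalClosure with hC
  have hCc : IsClosed (C : Set K) := S.isClosed_topologicalClosure
  have : CompleteSpace C := hCc.completeSpace_coe
  refine ⟨C.starProjection, isStarProjection_starProjection, ?_, fun X hX => ?_⟩
  · ext x
    rw [← sub_eq_zero]
    refine hτ _ fun u w => ?_
    have hmem : (τ u).adjoint (σ x) ∈ C :=
      S.le_topologicalClosure (Submodule.subset_span ⟨u, x, rfl⟩)
    rw [← ContinuousLinearMap.adjoint_inner_right, map_sub, mul_apply_eq_comp, hadj,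
      Submodule.starProjection_eq_self_iff.2 hmem, sub_self, inner_zero_right]
  · have h1 : S ≤ LinearMap.ker (X : K →ₗ[ℂ] K) := by
      refine Submodule.span_le.2 ?_
      rintro _ ⟨u, x, rfl⟩
      have h2 : R X (σ x) = 0 := by simpa using congrArg (fun f => f x) hX
      have h3 := hadj X u (σ x)
      rw [h2, map_zero] at h3
      exact h3.symm
    have h2 : C ≤ LinearMap.ker (X : K →ₗ[ℂ] K) :=
      S.topologicalClosure_minimal h1 X.isClosed_ker
    ext x
    exact h2 (C.starProjection_apply_mem x)

variable {HA HB : Type*}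
  [NormedAddCommGroup HA] [InnerProductSpace ℂ HA]
  [NormedAddCommGroup HB] [InnerProductSpace ℂ HB]

/-- The bounded operator `v ↦ v ⊗ w` from `HA` to `HA ⊗ HB`. -/
def tensorRight (w : HB) : HA →L[ℂ] HTensor HA HB :=
  UniformSpace.Completion.toComplL ∘L (TensorProduct.mkL ℂ HA HB).flip w

theorem tensorRight_apply (v : HA) (w : HB) : tensorRight w v = tensorLeft v w := by
  simp [tensorRight, tensorLeft]

variable [CompleteSpace HA] [CompleteSpace HB]

theorem exists_supportBob (σ : HTensor HA HB →L[ℂ] HTensor HA HB) :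
    ∃ E : HB →L[ℂ] HB, IsStarProjection E ∧ bobHom HA HB E * σ = σ ∧
      ∀ X, bobHom HA HB X * σ = 0 → X * E = 0 :=
  exists_supportProjection (fun u : HA => tensorLeft u) (fun _ => eq_zero_of_inner_tensorLeft)
    (bobHom HA HB) (fun X u w => by simp [bobHom_apply, opTensor_tensorLeft]) σ

theorem exists_supportAlice (σ : HTensor HA HB →L[ℂ] HTensor HA HB) :
    ∃ E : HA →L[ℂ] HA, IsStarProjection E ∧ aliceHom HA HB E * σ = σ ∧
      ∀ X, aliceHom HA HB X * σ = 0 → X * E = 0 :=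
  exists_supportProjection (fun w : HB => tensorRight w)
    (fun _ h => eq_zero_of_inner_tensorLeft fun a b => by rw [← tensorRight_apply]; exact h b a)
    (aliceHom HA HB) (fun X u w => by simp [aliceHom_apply, tensorRight_apply, opTensor_tensorLeft])
    σ

theorem mul_marginalBob_eq_zero {ρ : HTensor HA HB →L[ℂ] HTensor HA HB} {X : HB →L[ℂ] HB}
    (h : bobHom HA HB X * ρ = 0) : X * marginalBob ρ = 0 := by
  set f := fun i => (tensorLeft (K := HB) (basis HA i)).adjoint ∘L ρ ∘L
    tensorLeft (K := HB) (basis HA i) with hf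
  have hterm : ∀ i, X * f i = 0 := by
    intro i
    have h1 : X ∘L (tensorLeft (K := HB) (basis HA i)).adjoint =
        (tensorLeft (K := HB) (basis HA i)).adjoint ∘L bobHom HA HB X := by
      have h2 : bobHom HA HB (star X) ∘L tensorLeft (K := HB) (basis HA i) =
          tensorLeft (K := HB) (basis HA i) ∘L star X := by
        ext w; simp [bobHom_apply, opTensor_tensorLeft]
      have h3 := congrArg ContinuousLinearMap.adjoint h2
      rw [ContinuousLinearMap.adjoint_comp, ContinuousLinearMap.adjoint_comp, map_star,
        ContinuousLinearMap.star_eq_adjoint, ContinuousLinearMap.star_eq_adjoint,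
        ContinuousLinearMap.adjoint_adjoint, ContinuousLinearMap.adjoint_adjoint] at h3
      exact h3.symm
    rw [ContinuousLinearMap.mul_def, hf, ← ContinuousLinearMap.comp_assoc, h1]
    ext w
    have h4 : bobHom HA HB X (ρ (tensorLeft (basis HA i) w)) = 0 := by
      simpa using congrArg (fun g => g (tensorLeft (basis HA i) w)) h
    simp [h4]
  -- A divergent series has the value `0`, for which the claim holds as well.
  by_cases hs : Summable f
  · have h1 := hs.hasSum.mul_left X
    simp only [hterm] at h1
    exact h1.unique hasSum_zero
  · rw [marginalBob, tsum_eq_zero_of_not_summable hs, mul_zero]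

theorem eq_zero_of_fullRank_marginalBob {ρ : HTensor HA HB →L[ℂ] HTensor HA HB} {X : HB →L[ℂ] HB}
    (hρ : FullRank (marginalBob ρ)) (h : bobHom HA HB X * ρ = 0) : X = 0 := by
  have h1 := mul_marginalBob_eq_zero h
  have h2 : Set.EqOn X (0 : HB →L[ℂ] HB) (Set.range (marginalBob ρ)) := by
    rintro _ ⟨w, rfl⟩
    simpa using congrArg (fun g => g w) h1
  ext w
  exact congrFun (Continuous.ext_on hρ X.continuous (0 : HB →L[ℂ] HB).continuous h2) w

end Support

/-! ### The Bell operator as a sum of squares -/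

section SumOfSquares

theorem sum_fin_two_fun {d : ℕ} {M : Type*} [AddCommMonoid M] (f : (Fin 2 → Fin d) → M) :
    ∑ x, f x = ∑ j, ∑ k, f ![j, k] := by
  rw [← Fintype.sum_prod_type']
  exact (Fintype.sum_equiv (finTwoArrowEquiv (Fin d)).symm _ _ fun x => by simp).symm

/-- The sum-of-squares decomposition. Here `s j k` and `z j k` stand for the sum and the difference of
Alice's two conclusive effects on input `(j, k)`, and `p`, `q` for Bob's two measurements. -/
theorem bellOperator_sumOfSquares {d : ℕ} {𝓐 : Type*} [Ring 𝓐] [Algebra ℂ 𝓐] {t : ℂ} (ht : t ≠ 0)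
    (s z : Fin d → Fin d → 𝓐) (p q : Fin d → 𝓐) (hp : ∑ j, p j = 1) (hq : ∑ k, q k = 1)
    (hzp : ∀ j k, Commute (z j k) (p j)) (hzq : ∀ j k, Commute (z j k) (q k)) :
    (((d : ℂ) - 1) / t) • (1 : 𝓐) -
        ∑ j, ∑ k, (z j k * (p j - q k) - (t / 2) • s j k) =
      ∑ j, ∑ k, ((t / 2) • (s j k - z j k * z j k) +
        (1 / (2 * t)) • ((t • z j k - (p j - q k)) * (t • z j k - (p j - q k)))) +
      ((d : ℂ) / (2 * t)) • (∑ j, (p j - p j * p j) + ∑ k, (q k - q k * q k)) := by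
  have hterm : ∀ j k, (t / 2) • (s j k - z j k * z j k) +
      (1 / (2 * t)) • ((t • z j k - (p j - q k)) * (t • z j k - (p j - q k))) =
      (t / 2) • s j k - z j k * (p j - q k) + (1 / (2 * t)) • ((p j - q k) * (p j - q k)) := by
    intro j k
    have h1 := (hzp j k).eq
    have h2 := (hzq j k).eq
    simp only [mul_sub, sub_mul, smul_mul_assoc, mul_smul_comm, ← h1, ← h2]
    match_scalars <;> field_simp <;> ring
  have hD : ∑ j, ∑ k, (p j - q k) * (p j - q k) =
      (d : ℂ) • (∑ j, p j * p j + ∑ k, q k * q k) - (2 : ℂ) • (1 : 𝓐) := by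
    have e1 : ∑ j, ∑ k, p j * q k = 1 := by rw [← Finset.sum_mul_sum, hp, hq, one_mul]
    have e2 : ∑ j, ∑ k, q k * p j = 1 := by
      rw [Finset.sum_comm, ← Finset.sum_mul_sum, hp, hq, one_mul]
    have e3 : ∑ j, ∑ k, (p j - q k) * (p j - q k) =
        ∑ j, ∑ k : Fin d, p j * p j + ∑ j : Fin d, ∑ k, q k * q k - ∑ j, ∑ k, p j * q k -
          ∑ j, ∑ k, q k * p j := by
      simp only [← Finset.sum_add_distrib, ← Finset.sum_sub_distrib]
      refine Finset.sum_congr rfl fun j _ => Finset.sum_congr rfl fun k _ => ?_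
      noncomm_ring
    rw [e3, e1, e2]
    simp only [Finset.sum_const, Finset.card_univ, Fintype.card_fin, ← Finset.smul_sum,
      ← Nat.cast_smul_eq_nsmul ℂ]
    module
  simp only [hterm, Finset.sum_add_distrib, Finset.sum_sub_distrib, ← Finset.smul_sum, hD, hp, hq]
  match_scalars <;> field_simp <;> ring

variable {H : Type*} [NormedAddCommGroup H] [InnerProductSpace ℂ H] [CompleteSpace H]

theorem POVM.effect_nonneg {ι : Type*} [Fintype ι] (M : POVM ι H) (i : ι) : 0 ≤ M.effect i :=
  (ContinuousLinearMap.nonneg_iff_isPositive _).2 (M.isPositive i)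

theorem POVM.isSelfAdjoint {ι : Type*} [Fintype ι] (M : POVM ι H) (i : ι) :
    IsSelfAdjoint (M.effect i) :=
  (M.isPositive i).isSelfAdjoint

theorem POVM.effect_le_one {ι : Type*} [Fintype ι] (M : POVM ι H) (i : ι) : M.effect i ≤ 1 := by
  rw [← M.sum_effect]
  exact Finset.single_le_sum (f := M.effect) (fun j _ => M.effect_nonneg j) (Finset.mem_univ i)

theorem POVM.effect_sub_mul_self_nonneg {ι : Type*} [Fintype ι] (M : POVM ι H) (i : ι) :
    0 ≤ M.effect i - M.effect i * M.effect i := by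
  set P := M.effect i
  have h1 : 0 ≤ P := M.effect_nonneg i
  have h2 : 0 ≤ 1 - P := sub_nonneg.2 (M.effect_le_one i)
  have e : P - P * P = P * (1 - P) * P + (1 - P) * P * (1 - P) := by noncomm_ring
  rw [e]
  exact add_nonneg (IsSelfAdjoint.conjugate_nonneg h2 (.of_nonneg h1))
    (IsSelfAdjoint.conjugate_nonneg h1 (.of_nonneg h2))

/-- The difference of the two conclusive effects of a measurement with an inconclusive outcome. -/
def POVM.diff (M : POVM (Option (Fin 2)) H) : H →L[ℂ] H := M.effect (some 0) - M.effect (some 1)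

/-- The sum of the two conclusive effects of a measurement with an inconclusive outcome. -/
def POVM.conclusive (M : POVM (Option (Fin 2)) H) : H →L[ℂ] H :=
  M.effect (some 0) + M.effect (some 1)

theorem POVM.diff_isSelfAdjoint (M : POVM (Option (Fin 2)) H) : IsSelfAdjoint M.diff :=
  (M.isSelfAdjoint _).sub (M.isSelfAdjoint _)

theorem POVM.effect_none (M : POVM (Option (Fin 2)) H) : M.effect none = 1 - M.conclusive := by
  rw [← M.sum_effect, Fintype.sum_option, Fin.sum_univ_two, POVM.conclusive]
  abel

theorem POVM.diff_mul_effect_none_mul_diff_nonneg (M : POVM (Option (Fin 2)) H) :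
    0 ≤ M.diff * M.effect none * M.diff :=
  IsSelfAdjoint.conjugate_nonneg (M.effect_nonneg none) M.diff_isSelfAdjoint

/-- A quantitative form of `(A₁ - A₂)² ≤ A₁ + A₂`. -/
theorem POVM.diff_mul_effect_none_mul_diff_le (M : POVM (Option (Fin 2)) H) :
    M.diff * M.effect none * M.diff ≤ M.conclusive - M.diff * M.diff := by
  have h : M.conclusive - M.diff * M.diff - M.diff * M.effect none * M.diff =
      (1 - M.diff) * M.effect (some 0) * (1 - M.diff) +
        (1 + M.diff) * M.effect (some 1) * (1 + M.diff) := by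
    rw [POVM.effect_none, POVM.conclusive, POVM.diff]
    noncomm_ring
  rw [← sub_nonneg, h]
  exact add_nonneg
    (IsSelfAdjoint.conjugate_nonneg (M.effect_nonneg _)
      ((IsSelfAdjoint.one _).sub M.diff_isSelfAdjoint))
    (IsSelfAdjoint.conjugate_nonneg (M.effect_nonneg _)
      ((IsSelfAdjoint.one _).add M.diff_isSelfAdjoint))

theorem POVM.conclusive_sub_diff_mul_diff_nonneg (M : POVM (Option (Fin 2)) H) :
    0 ≤ M.conclusive - M.diff * M.diff :=
  M.diff_mul_effect_none_mul_diff_nonneg.trans M.diff_mul_effect_none_mul_diff_le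

end SumOfSquares

section Value

variable {d : ℕ} {HA HB : Type*}
  [NormedAddCommGroup HA] [InnerProductSpace ℂ HA] [CompleteSpace HA]
  [NormedAddCommGroup HB] [InnerProductSpace ℂ HB] [CompleteSpace HB]

namespace Realisation

variable (R : Realisation d HA HB)

/-- The difference of Alice's conclusive effects for input `(j, k)`, on the joint system. -/
def aliceDiff (j k : Fin d) : HTensor HA HB →L[ℂ] HTensor HA HB :=
  aliceHom HA HB (R.alice ![j, k]).diff

/-- The sum of Alice's conclusive effects for input `(j, k)`, on the joint system. -/
def aliceConclusive (j k : Fin d) : HTensor HA HB →L[ℂ] HTensor HA HB :=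
  aliceHom HA HB (R.alice ![j, k]).conclusive

/-- Bob's effects on the joint system. -/
def bobEffect (y : Fin 2) (b : Fin d) : HTensor HA HB →L[ℂ] HTensor HA HB :=
  bobHom HA HB ((R.bob y).effect b)

theorem sum_bobEffect (y : Fin 2) : ∑ b, R.bobEffect y b = 1 := by
  simp only [bobEffect]
  rw [← map_sum, (R.bob y).sum_effect, map_one]

theorem bellValue_eq_expect :
    R.bellValue = (R.isDensity.expect (∑ j, ∑ k,
      (R.aliceDiff j k * (R.bobEffect 0 j - R.bobEffect 1 k) -
        (((√(((d : ℝ) - 1) / d) : ℝ) : ℂ) / 2) • R.aliceConclusive j k))).re := by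
  have h1 : ∀ a b x y, R.prob a b x y = (R.isDensity.expect
      (aliceHom HA HB ((R.alice x).effect a) * R.bobEffect y b)).re := fun a b x y => by
    rw [prob, bobEffect, aliceHom_mul_bobHom]; rfl
  have h2 : ∀ a x, R.probAlice a x =
      (R.isDensity.expect (aliceHom HA HB ((R.alice x).effect a))).re := fun a x => rfl
  have h3 : ∀ (c : ℝ) (X : HTensor HA HB →L[ℂ] HTensor HA HB),
      (R.isDensity.expect (((c : ℂ) / 2) • X)).re = 1 / 2 * c * (R.isDensity.expect X).re := by
    intro c X
    have : (c : ℂ) / 2 = ((1 / 2 * c : ℝ) : ℂ) := by push_cast; ring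
    rw [this, map_smul, smul_eq_mul, Complex.re_ofReal_mul]
  rw [bellValue, score, sum_fin_two_fun, sum_fin_two_fun, map_sum, Complex.re_sum, Finset.mul_sum,
    ← Finset.sum_sub_distrib]
  refine Finset.sum_congr rfl fun j _ => ?_
  rw [map_sum, Complex.re_sum, Finset.mul_sum, ← Finset.sum_sub_distrib]
  refine Finset.sum_congr rfl fun k _ => ?_
  rw [map_sub, Complex.sub_re, h3]
  simp only [Fin.sum_univ_two, h1, h2, aliceDiff, aliceConclusive, POVM.diff, POVM.conclusive,
    map_sub, map_add, sub_mul, mul_sub, Complex.sub_re, Complex.add_re]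
  simp [Fin.rev]
  ring

/-- The gap between the value of the Bell functional and its quantum bound, as a sum of
expectation values of positive operators. -/
theorem bound_sub_bellValue (t : ℝ) (ht : 0 < t) (htd : √(((d : ℝ) - 1) / d) = t) :
    ((d : ℝ) - 1) / t - R.bellValue =
      ∑ j, ∑ k, (t / 2 * (R.isDensity.expect
          (R.aliceConclusive j k - R.aliceDiff j k * R.aliceDiff j k)).re +
        1 / (2 * t) * (R.isDensity.expect
          (((t : ℂ) • R.aliceDiff j k - (R.bobEffect 0 j - R.bobEffect 1 k)) *
            ((t : ℂ) • R.aliceDiff j k - (R.bobEffect 0 j - R.bobEffect 1 k)))).re) +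
      d / (2 * t) *
        (∑ j, (R.isDensity.expect (R.bobEffect 0 j - R.bobEffect 0 j * R.bobEffect 0 j)).re +
          ∑ k, (R.isDensity.expect (R.bobEffect 1 k - R.bobEffect 1 k * R.bobEffect 1 k)).re) := by
  have h := bellOperator_sumOfSquares (𝓐 := HTensor HA HB →L[ℂ] HTensor HA HB)
    (Complex.ofReal_ne_zero.2 ht.ne') R.aliceConclusive R.aliceDiff (R.bobEffect 0) (R.bobEffect 1)
    (R.sum_bobEffect 0) (R.sum_bobEffect 1) (fun j k => aliceHom_commute_bobHom _ _)
    (fun j k => aliceHom_commute_bobHom _ _)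
  have h2 := congrArg (fun X => (R.isDensity.expect X).re) h
  have e1 : ((d : ℂ) - 1) / t = (((d : ℝ) - 1) / t : ℝ) := by push_cast; rfl
  have e2 : (t : ℂ) / 2 = (t / 2 : ℝ) := by push_cast; rfl
  have e3 : 1 / (2 * (t : ℂ)) = (1 / (2 * t) : ℝ) := by push_cast; rfl
  have e4 : (d : ℂ) / (2 * (t : ℂ)) = ((d : ℝ) / (2 * t) : ℝ) := by push_cast; rfl
  rw [bellValue_eq_expect, htd]
  simp only [map_sub (R.isDensity.expect) ((_ : ℂ) • _) _, map_smul, R.isDensity.expect_one] at h2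
  simp only [map_add, map_sum, map_smul, e1, e2, e3, e4, Complex.sub_re, Complex.add_re, Complex.re_sum, smul_eq_mul,
    Complex.re_ofReal_mul, mul_one, Complex.ofReal_re] at h2 ⊢
  exact h2

end Realisation

end Value

/-! ### Relations at the quantum bound -/

section Extremal

theorem pow_mul_eq_pow_mul_of_commute {M : Type*} [Monoid M] {a b s : M} (hab : Commute a b)
    (h : a * s = b * s) (n : ℕ) : a ^ n * s = b ^ n * s := by
  induction n with
  | zero => simp
  | succ n ih =>
    rw [pow_succ, mul_assoc, h, ← mul_assoc, (hab.pow_left n).eq, mul_assoc, ih, ← mul_assoc,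
      ← pow_succ']

variable {d : ℕ} {HA HB : Type*}
  [NormedAddCommGroup HA] [InnerProductSpace ℂ HA] [CompleteSpace HA]
  [NormedAddCommGroup HB] [InnerProductSpace ℂ HB] [CompleteSpace HB]

namespace Realisation

variable (R : Realisation d HA HB)

theorem aliceConclusive_sub_nonneg (j k : Fin d) :
    0 ≤ R.aliceConclusive j k - R.aliceDiff j k * R.aliceDiff j k := by
  rw [aliceConclusive, aliceDiff, ← map_mul, ← map_sub]
  exact map_nonneg _ (R.alice ![j, k]).conclusive_sub_diff_mul_diff_nonneg

theorem bobEffect_isSelfAdjoint (y : Fin 2) (b : Fin d) : IsSelfAdjoint (R.bobEffect y b) :=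
  ((R.bob y).isSelfAdjoint b).map (bobHom HA HB)

theorem bobEffect_sub_nonneg (y : Fin 2) (b : Fin d) :
    0 ≤ R.bobEffect y b - R.bobEffect y b * R.bobEffect y b := by
  rw [bobEffect, ← map_mul, ← map_sub]
  exact map_nonneg _ ((R.bob y).effect_sub_mul_self_nonneg b)

theorem isSelfAdjoint_smul_aliceDiff_sub (t : ℝ) (j k : Fin d) :
    IsSelfAdjoint ((t : ℂ) • R.aliceDiff j k - (R.bobEffect 0 j - R.bobEffect 1 k)) := 
  isSelfAdjoint_smul_sub_sub t ((R.alice ![j, k]).diff_isSelfAdjoint.map (aliceHom HA HB))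
    (R.bobEffect_isSelfAdjoint 0 j) (R.bobEffect_isSelfAdjoint 1 k)

theorem smul_aliceDiff_sub_mul_self_nonneg (t : ℝ) (j k : Fin d) :
    0 ≤ ((t : ℂ) • R.aliceDiff j k - (R.bobEffect 0 j - R.bobEffect 1 k)) *
      ((t : ℂ) • R.aliceDiff j k - (R.bobEffect 0 j - R.bobEffect 1 k)) := by
  have h := star_mul_self_nonneg
    ((t : ℂ) • R.aliceDiff j k - (R.bobEffect 0 j - R.bobEffect 1 k))
  rwa [(R.isSelfAdjoint_smul_aliceDiff_sub t j k).star_eq] at h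

section Bound

variable {R} {t : ℝ} (ht : 0 < t) (htd : √(((d : ℝ) - 1) / d) = t)
  (hd : 0 < d) (hR : ((d : ℝ) - 1) / t ≤ R.bellValue)

include ht htd hd hR

/-- At the quantum bound every term of the sum-of-squares decomposition has expectation zero. -/
theorem expect_eq_zero :
    (∀ j k, (R.isDensity.expect
        (R.aliceConclusive j k - R.aliceDiff j k * R.aliceDiff j k)).re = 0) ∧
      (∀ j k, (R.isDensity.expect
        (((t : ℂ) • R.aliceDiff j k - (R.bobEffect 0 j - R.bobEffect 1 k)) *
          ((t : ℂ) • R.aliceDiff j k - (R.bobEffect 0 j - R.bobEffect 1 k)))).re = 0) ∧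
      ∀ y b, (R.isDensity.expect (R.bobEffect y b - R.bobEffect y b * R.bobEffect y b)).re = 0 := by
  have hd' : (0 : ℝ) < d := by exact_mod_cast hd
  have hb : ∀ y b, 0 ≤ (R.isDensity.expect
      (R.bobEffect y b - R.bobEffect y b * R.bobEffect y b)).re := fun y b =>
    R.isDensity.expect_nonneg (R.bobEffect_sub_nonneg y b)
  have ha : ∀ j k, 0 ≤ t / 2 * (R.isDensity.expect
      (R.aliceConclusive j k - R.aliceDiff j k * R.aliceDiff j k)).re := fun j k =>
    mul_nonneg (by positivity) (R.isDensity.expect_nonneg (R.aliceConclusive_sub_nonneg j k))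
  have hz : ∀ j k, 0 ≤ 1 / (2 * t) * (R.isDensity.expect
      (((t : ℂ) • R.aliceDiff j k - (R.bobEffect 0 j - R.bobEffect 1 k)) *
        ((t : ℂ) • R.aliceDiff j k - (R.bobEffect 0 j - R.bobEffect 1 k)))).re := fun j k =>
    mul_nonneg (by positivity) (R.isDensity.expect_nonneg (R.smul_aliceDiff_sub_mul_self_nonneg t j k))
  have h := R.bound_sub_bellValue t ht htd
  have hle := sub_nonpos.2 hR
  rw [h] at hle
  have hs1 := Finset.sum_nonneg (s := Finset.univ) fun j _ =>
    Finset.sum_nonneg (s := Finset.univ) fun k _ => add_nonneg (ha j k) (hz j k)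
  have hs2 := Finset.sum_nonneg (s := Finset.univ) fun b _ => hb 0 b
  have hs3 := Finset.sum_nonneg (s := Finset.univ) fun b _ => hb 1 b
  have hc : (0 : ℝ) < d / (2 * t) := by positivity
  have hs4 := mul_nonneg hc.le (add_nonneg hs2 hs3)
  have e1 := le_antisymm (by linarith) hs1
  have e4 := (mul_eq_zero.1 (le_antisymm (by linarith) hs4)).resolve_left hc.ne'
  have e2 := le_antisymm (by linarith) hs2
  have e3 := le_antisymm (by linarith) hs3
  have e5 : ∀ j k, _ := fun j k => (Finset.sum_eq_zero_iff_of_nonneg fun k _ =>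
    add_nonneg (ha j k) (hz j k)).1 ((Finset.sum_eq_zero_iff_of_nonneg fun j _ =>
      Finset.sum_nonneg fun k _ => add_nonneg (ha j k) (hz j k)).1 e1 j (Finset.mem_univ j)) k
        (Finset.mem_univ k)
  refine ⟨fun j k => ?_, fun j k => ?_, fun y b => ?_⟩
  · exact (mul_eq_zero.1 (le_antisymm (by linarith [e5 j k, hz j k]) (ha j k))).resolve_left
      (by positivity)
  · exact (mul_eq_zero.1 (le_antisymm (by linarith [e5 j k, ha j k]) (hz j k))).resolve_left
      (by positivity)
  · fin_cases y
    · exact (Finset.sum_eq_zero_iff_of_nonneg fun b _ => hb 0 b).1 e2 b (Finset.mem_univ b)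
    · exact (Finset.sum_eq_zero_iff_of_nonneg fun b _ => hb 1 b).1 e3 b (Finset.mem_univ b)

theorem bobEffect_mul_bobEffect_mul_root (y : Fin 2) (b : Fin d) :
    R.bobEffect y b * R.bobEffect y b * R.isDensity.root = R.bobEffect y b * R.isDensity.root := by
  have h := R.isDensity.mul_root_eq_zero_of_nonneg (R.bobEffect_sub_nonneg y b)
    ((expect_eq_zero ht htd hd hR).2.2 y b)
  rw [sub_mul, sub_eq_zero] at h
  exact h.symm

/-- On the state, Alice's observable for input `(j, k)` is a multiple of Bob's `P_j - Q_k`. -/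
theorem smul_aliceDiff_mul_root (j k : Fin d) :
    (t : ℂ) • R.aliceDiff j k * R.isDensity.root = (R.bobEffect 0 j - R.bobEffect 1 k) * R.isDensity.root := by
  have h := R.isDensity.mul_root_eq_zero
    (Y := (t : ℂ) • R.aliceDiff j k - (R.bobEffect 0 j - R.bobEffect 1 k))
    (by rw [(R.isSelfAdjoint_smul_aliceDiff_sub t j k).star_eq]
        exact (expect_eq_zero ht htd hd hR).2.1 j k)
  rwa [sub_mul, sub_eq_zero] at h

/-- On the state, Alice's observable has spectrum in `{-1, 0, 1}`, as for a projective measurement. -/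
theorem aliceDiff_pow_three_mul_root (j k : Fin d) :
    R.aliceDiff j k ^ 3 * R.isDensity.root = R.aliceDiff j k * R.isDensity.root := by
  set M := R.alice ![j, k]
  have h0 := (expect_eq_zero ht htd hd hR).1 j k
  have hS : R.aliceConclusive j k * R.isDensity.root = R.aliceDiff j k * R.aliceDiff j k * R.isDensity.root := by
    rw [← sub_eq_zero, ← sub_mul]
    exact R.isDensity.mul_root_eq_zero_of_nonneg (R.aliceConclusive_sub_nonneg j k) h0
  -- The inconclusive effect annihilates the image of the state under the observable.
  have hN : R.aliceConclusive j k * R.aliceDiff j k * R.isDensity.root = R.aliceDiff j k * R.isDensity.root := by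
    have h1 : 0 ≤ (R.isDensity.expect (aliceHom HA HB (M.diff * M.effect none * M.diff))).re :=
      R.isDensity.expect_nonneg (map_nonneg _ M.diff_mul_effect_none_mul_diff_nonneg)
    have h2 : 0 ≤ (R.isDensity.expect (aliceHom HA HB
        (M.conclusive - M.diff * M.diff - M.diff * M.effect none * M.diff))).re :=
      R.isDensity.expect_nonneg (map_nonneg _ (sub_nonneg.2 M.diff_mul_effect_none_mul_diff_le))
    rw [map_sub, map_sub (aliceHom HA HB) M.conclusive, map_mul (aliceHom HA HB) M.diff M.diff,
      map_sub R.isDensity.expect, Complex.sub_re] at h2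
    have h3 : (R.isDensity.expect (aliceHom HA HB (M.diff * M.effect none * M.diff))).re = 0 := by
      have h0' : (R.isDensity.expect ((aliceHom HA HB) M.conclusive -
        (aliceHom HA HB) M.diff * (aliceHom HA HB) M.diff)).re = 0 := h0
      linarith
    have hs := CFC.sqrt_mul_sqrt_self _ (M.effect_nonneg none)
    have hsa := (IsSelfAdjoint.of_nonneg (CFC.sqrt_nonneg (M.effect none))).star_eq
    have h4 := R.isDensity.mul_root_eq_zero
      (Y := aliceHom HA HB (CFC.sqrt (M.effect none) * M.diff)) (by
        rw [← map_star, ← map_mul, star_mul, hsa, M.diff_isSelfAdjoint.star_eq, mul_assoc,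
          ← mul_assoc (CFC.sqrt _), hs, ← mul_assoc]
        exact h3)
    have h5 : aliceHom HA HB (M.effect none * M.diff) * R.isDensity.root = 0 := by
      rw [← hs, mul_assoc, map_mul, mul_assoc, h4, mul_zero]
    rw [M.effect_none, sub_mul, one_mul, map_sub, map_mul, sub_mul, sub_eq_zero] at h5
    exact h5.symm
  have hZ : R.aliceDiff j k * R.isDensity.root =
      (1 / t : ℂ) • ((R.bobEffect 0 j - R.bobEffect 1 k) * R.isDensity.root) := by
    rw [← smul_aliceDiff_mul_root ht htd hd hR, smul_mul_assoc, smul_smul, one_div_mul_cancel,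
      one_smul]
    exact Complex.ofReal_ne_zero.2 ht.ne'
  have hcomm : ∀ X, Commute (aliceHom HA HB X) (R.bobEffect 0 j - R.bobEffect 1 k) := fun X =>
    (aliceHom_commute_bobHom _ _).sub_right (aliceHom_commute_bobHom _ _)
  -- As the observable acts on the state like an operator of Bob, relations satisfied by
  -- Alice's operators on the state persist on its image under the observable.
  have hlift : ∀ X, aliceHom HA HB X * R.isDensity.root = 0 →
      aliceHom HA HB X * (R.aliceDiff j k * R.isDensity.root) = 0 := by
    intro X hX
    rw [hZ, mul_smul_comm, ← mul_assoc, (hcomm X).eq, mul_assoc, hX, mul_zero, smul_zero]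
  have h6 := hlift (M.conclusive - M.diff * M.diff) (by
    rw [map_sub, map_mul, sub_mul, sub_eq_zero]; exact hS)
  rw [map_sub, map_mul, sub_mul, sub_eq_zero] at h6
  calc R.aliceDiff j k ^ 3 * R.isDensity.root
      = R.aliceDiff j k * R.aliceDiff j k * (R.aliceDiff j k * R.isDensity.root) := by noncomm_ring
    _ = R.aliceConclusive j k * (R.aliceDiff j k * R.isDensity.root) := h6.symm
    _ = R.aliceDiff j k * R.isDensity.root := by rw [← mul_assoc, hN]

theorem bobDiff_pow_three_mul_root (j k : Fin d) :
    (R.bobEffect 0 j - R.bobEffect 1 k) ^ 3 * R.isDensity.root =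
      ((t : ℂ) ^ 2) • (R.bobEffect 0 j - R.bobEffect 1 k) * R.isDensity.root := by
  have h1 := smul_aliceDiff_mul_root ht htd hd hR j k
  have hcomm : Commute ((t : ℂ) • R.aliceDiff j k) (R.bobEffect 0 j - R.bobEffect 1 k) :=
    Commute.smul_left
      ((aliceHom_commute_bobHom _ _).sub_right (aliceHom_commute_bobHom _ _)) _
  rw [← pow_mul_eq_pow_mul_of_commute hcomm h1, smul_mul_assoc, ← h1, smul_pow, smul_mul_assoc,
    aliceDiff_pow_three_mul_root ht htd hd hR, smul_mul_assoc, smul_smul, pow_succ]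

end Bound

/-- Alice's counterparts of Bob's effects: the combinations of her observables that act on an optimal
state like `P_b` (for `y = 0`) and `Q_b` (for `y = 1`). -/
def aliceCopy (t : ℝ) (y : Fin 2) (b : Fin d) : HA →L[ℂ] HA :=
  (1 / d : ℂ) • (1 + (t : ℂ) • if y = 0 then ∑ k, (R.alice ![b, k]).diff
    else -∑ j, (R.alice ![j, b]).diff)

theorem aliceCopy_isSelfAdjoint (t : ℝ) (y : Fin 2) (b : Fin d) :
    IsSelfAdjoint (R.aliceCopy t y b) := by
  have hc : IsSelfAdjoint (1 / d : ℂ) := by simp [isSelfAdjoint_iff]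
  refine IsSelfAdjoint.smul hc ((IsSelfAdjoint.one _).add
    (IsSelfAdjoint.smul (Complex.conj_ofReal t) ?_))
  split_ifs
  · exact isSelfAdjoint_sum _ fun k _ => (R.alice ![b, k]).diff_isSelfAdjoint
  · exact (isSelfAdjoint_sum _ fun j _ => (R.alice ![j, b]).diff_isSelfAdjoint).neg

theorem aliceCopy_mul_root {R : Realisation d HA HB} {t : ℝ} (ht : 0 < t)
    (htd : √(((d : ℝ) - 1) / d) = t) (hd : 0 < d)
    (hR : ((d : ℝ) - 1) / t ≤ R.bellValue) (y : Fin 2) (b : Fin d) :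
    aliceHom HA HB (R.aliceCopy t y b) * R.isDensity.root = R.bobEffect y b * R.isDensity.root := by
  have hd' : (d : ℂ) ≠ 0 := by exact_mod_cast hd.ne'
  have h1 := smul_aliceDiff_mul_root ht htd hd hR
  fin_cases y
  · have h2 : (t : ℂ) • ((∑ k, R.aliceDiff b k) * R.isDensity.root) =
        (d : ℂ) • (R.bobEffect 0 b * R.isDensity.root) - R.isDensity.root := by
      rw [Finset.sum_mul, Finset.smul_sum]
      simp only [← smul_mul_assoc, h1]
      rw [← Finset.sum_mul, Finset.sum_sub_distrib, R.sum_bobEffect, sub_mul, one_mul]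
      simp [← Nat.cast_smul_eq_nsmul ℂ]
    have h3 : aliceHom HA HB (R.aliceCopy t 0 b) =
        (1 / d : ℂ) • (1 + (t : ℂ) • ∑ k, R.aliceDiff b k) := by
      rw [aliceCopy, if_pos rfl, map_smul, map_add, map_one, map_smul, map_sum]; rfl
    change aliceHom HA HB (R.aliceCopy t 0 b) * _ = R.bobEffect 0 b * _
    rw [h3, smul_mul_assoc, add_mul, one_mul, smul_mul_assoc, h2, add_sub_cancel, smul_smul,
      one_div_mul_cancel hd', one_smul]
  · have h2 : (t : ℂ) • ((∑ j, R.aliceDiff j b) * R.isDensity.root) =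
        R.isDensity.root - (d : ℂ) • (R.bobEffect 1 b * R.isDensity.root) := by
      rw [Finset.sum_mul, Finset.smul_sum]
      simp only [← smul_mul_assoc, h1]
      rw [← Finset.sum_mul, Finset.sum_sub_distrib, R.sum_bobEffect, sub_mul, one_mul]
      simp [← Nat.cast_smul_eq_nsmul ℂ]
    have h3 : aliceHom HA HB (R.aliceCopy t 1 b) =
        (1 / d : ℂ) • (1 - (t : ℂ) • ∑ j, R.aliceDiff j b) := by
      rw [aliceCopy, if_neg one_ne_zero, map_smul, map_add, map_one, map_smul, map_neg, map_sum,
        smul_neg, ← sub_eq_add_neg]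
      rfl
    change aliceHom HA HB (R.aliceCopy t 1 b) * _ = R.bobEffect 1 b * _
    rw [h3, smul_mul_assoc, sub_mul, one_mul, smul_mul_assoc, h2, sub_sub_cancel, smul_smul,
      one_div_mul_cancel hd', one_smul]

end Realisation

end Extremal

/-! ### Mutually unbiased measurements on the local supports -/

section MUB

variable {K : Type*} [NormedAddCommGroup K] [InnerProductSpace ℂ K] [CompleteSpace K] {d : ℕ}

/-- Projections that sum to a projection are mutually orthogonal. -/
theorem mul_eq_zero_of_sum_eq_projection {ι : Type*} [Fintype ι] {p : ι → K →L[ℂ] K}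
    {E : K →L[ℂ] K} (hp : ∀ i, IsStarProjection (p i)) (hpE : ∀ i, p i * E = p i)
    (hsum : ∑ i, p i = E) {i j : ι} (hij : i ≠ j) : p i * p j = 0 := by
  classical
  have hnn : ∀ l, 0 ≤ p j * p l * p j := fun l =>
    IsSelfAdjoint.conjugate_nonneg (hp l).nonneg (hp j).isSelfAdjoint
  have h1 : ∑ l, p j * p l * p j = p j := by
    rw [← Finset.sum_mul, ← Finset.mul_sum, hsum, hpE, (hp j).isIdempotentElem.eq]
  rw [← Finset.add_sum_erase _ _ (Finset.mem_univ j), (hp j).isIdempotentElem.eq,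
    (hp j).isIdempotentElem.eq, add_eq_left] at h1
  have h2 := (Finset.sum_eq_zero_iff_of_nonneg fun l _ => hnn l).1 h1 i
    (Finset.mem_erase.2 ⟨hij, Finset.mem_univ _⟩)
  have h3 : star (p i * p j) * (p i * p j) = 0 := by
    rw [star_mul, (hp i).isSelfAdjoint.star_eq, (hp j).isSelfAdjoint.star_eq, mul_assoc,
      ← mul_assoc (p i), (hp i).isIdempotentElem.eq, ← mul_assoc, h2]
  exact CStarRing.star_mul_self_eq_zero_iff _ |>.1 h3

/-- A pair of projective measurements on the range of the projection `E` (that is, summing to `E`)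
that are mutually unbiased in the sense `p = d p q p` and `q = d q p q`. -/
structure IsMUBOn (E : K →L[ℂ] K) (p q : Fin d → K →L[ℂ] K) : Prop where
  projE : IsStarProjection E
  projP : ∀ j, IsStarProjection (p j)
  projQ : ∀ k, IsStarProjection (q k)
  mulP : ∀ j, p j * E = p j
  mulQ : ∀ k, q k * E = q k
  sumP : ∑ j, p j = E
  sumQ : ∑ k, q k = E
  unbiasedP : ∀ j k, (d : ℂ) • (p j * q k * p j) = p j
  unbiasedQ : ∀ j k, (d : ℂ) • (q k * p j * q k) = q k

/-- The relation `(p - q)³ = (1 - 1/d) (p - q)` says that `d (p q p - q p q) = p - q`; summing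
over one of the two indices gives unbiasedness. -/
theorem smul_mul_mul_eq_of_pow_three {E : K →L[ℂ] K} {p q : Fin d → K →L[ℂ] K}
    (hd : 0 < d) (hp : ∀ j, IsStarProjection (p j)) (hq : ∀ k, IsStarProjection (q k))
    (hpE : ∀ j, p j * E = p j) (hqE : ∀ k, q k * E = q k) (hsq : ∑ k, q k = E)
    (h : ∀ j k, (p j - q k) ^ 3 = (((d : ℂ) - 1) / d) • (p j - q k)) (j k : Fin d) :
    (d : ℂ) • (q k * p j * q k) = q k := by
  have hd' : (d : ℂ) ≠ 0 := by exact_mod_cast hd.ne'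
  have h1 : ∀ l, (d : ℂ) • (q l * p j * q l) = (d : ℂ) • (p j * q l * p j) - (p j - q l) := by
    intro l
    have e : (p j - q l) ^ 3 = p j - q l - p j * q l * p j + q l * p j * q l := by
      have h1 := (hp j).isIdempotentElem.eq
      have h2 := (hq l).isIdempotentElem.eq
      simp only [pow_succ, pow_zero, one_mul, sub_mul, mul_sub, h1, h2, mul_assoc]
      simp only [← mul_assoc]
      abel
    have e2 := h j l
    rw [e] at e2
    have e3 : q l * p j * q l =
        (((d : ℂ) - 1) / d) • (p j - q l) - (p j - q l) + p j * q l * p j := by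
      rw [← e2]; abel
    rw [e3]
    match_scalars <;> field_simp <;> ring
  have h2 : ∑ l, (d : ℂ) • (q l * p j * q l) = E := by
    simp only [h1, Finset.sum_sub_distrib]
    rw [← Finset.smul_sum, ← Finset.sum_mul, ← Finset.mul_sum, hsq, hpE,
      (hp j).isIdempotentElem.eq]
    simp [← Nat.cast_smul_eq_nsmul ℂ]
  have h3 := congrArg (q k * ·) h2
  simp only [Finset.mul_sum, hqE, mul_smul_comm] at h3
  rw [Finset.sum_eq_single k (fun l _ hl => by
    rw [mul_assoc, ← mul_assoc, mul_eq_zero_of_sum_eq_projection hq hqE hsq hl.symm, zero_mul,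
      smul_zero]) (by simp)] at h3
  rwa [mul_assoc, ← mul_assoc, (hq k).isIdempotentElem.eq, ← mul_assoc] at h3

/-- Let `σ` be an operator on a larger system into which the operators on `K` are embedded by `R`, and
let `E` be the projection onto its support in `K`. If `P` and `Q` satisfy on `σ` the relations
characterising an optimal strategy, and can be moved to the other side of the system, then their
restrictions to the support are mutually unbiased. -/
theorem isMUBOn_support {𝓗 : Type*} [NormedAddCommGroup 𝓗] [InnerProductSpace ℂ 𝓗]
    [CompleteSpace 𝓗] {R : (K →L[ℂ] K) →⋆ₐ[ℂ] (𝓗 →L[ℂ] 𝓗)} {σ : 𝓗 →L[ℂ] 𝓗} (hd : 0 < d)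
    {E : K →L[ℂ] K} (hE : IsStarProjection E) (hEσ : R E * σ = σ)
    (hsupp : ∀ X, R X * σ = 0 → X * E = 0)
    {P Q : Fin d → K →L[ℂ] K} (hPsa : ∀ j, IsSelfAdjoint (P j)) (hQsa : ∀ k, IsSelfAdjoint (Q k))
    {P' Q' : Fin d → 𝓗 →L[ℂ] 𝓗} (hP'R : ∀ j X, Commute (P' j) (R X))
    (hQ'R : ∀ k X, Commute (Q' k) (R X))
    (hP' : ∀ j, P' j * σ = R (P j) * σ) (hQ' : ∀ k, Q' k * σ = R (Q k) * σ)
    (hPP : ∀ j, R (P j * P j) * σ = R (P j) * σ) (hQQ : ∀ k, R (Q k * Q k) * σ = R (Q k) * σ)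
    (hPsum : R (∑ j, P j) * σ = σ) (hQsum : R (∑ k, Q k) * σ = σ)
    (hcub : ∀ j k, R ((P j - Q k) ^ 3) * σ = R ((((d : ℂ) - 1) / d) • (P j - Q k)) * σ) :
    IsMUBOn E (fun j => P j * E) (fun k => Q k * E) ∧
      (∀ j, Commute (P j) E) ∧ ∀ k, Commute (Q k) E := by
  have hcancel : ∀ {X Y : K →L[ℂ] K}, R X * σ = R Y * σ → X * E = Y * E := by
    intro X Y h
    rw [← sub_eq_zero, ← sub_mul]
    exact hsupp _ (by rw [map_sub, sub_mul, h, sub_self])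
  have hE2 := hE.isIdempotentElem.eq
  have hEsa := hE.isSelfAdjoint.star_eq
  have hcomm : ∀ {X : K →L[ℂ] K} {X' : 𝓗 →L[ℂ] 𝓗}, IsSelfAdjoint X →
      (∀ Y, Commute X' (R Y)) → X' * σ = R X * σ → Commute X E := by
    intro X X' hX hX' h
    have h1 : E * X * E = X * E := hcancel (by
      rw [map_mul, mul_assoc, ← h, ← mul_assoc, ← (hX' E).eq, mul_assoc, hEσ])
    have h2 := congrArg star h1
    rw [star_mul, star_mul, star_mul, hEsa, hX.star_eq, ← mul_assoc, h1] at h2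
    exact h2
  have cP : ∀ j, Commute (P j) E := fun j => hcomm (hPsa j) (hP'R j) (hP' j)
  have cQ : ∀ k, Commute (Q k) E := fun k => hcomm (hQsa k) (hQ'R k) (hQ' k)
  have hproj : ∀ {X : K →L[ℂ] K}, IsSelfAdjoint X → Commute X E → R (X * X) * σ = R X * σ →
      IsStarProjection (X * E) := by
    intro X hX hXE h
    refine ⟨?_, ?_⟩
    · change X * E * (X * E) = X * E
      rw [mul_assoc, ← mul_assoc E, ← hXE.eq, mul_assoc, hE2, ← mul_assoc, hcancel h]
    · rw [IsSelfAdjoint, star_mul, hEsa, hX.star_eq, hXE.eq]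
  have pP := fun j => hproj (hPsa j) (cP j) (hPP j)
  have pQ := fun k => hproj (hQsa k) (cQ k) (hQQ k)
  have mP : ∀ j, P j * E * E = P j * E := fun j => by rw [mul_assoc, hE2]
  have mQ : ∀ k, Q k * E * E = Q k * E := fun k => by rw [mul_assoc, hE2]
  have sP : ∑ j, P j * E = E := by
    rw [← Finset.sum_mul, hcancel (Y := 1) (by rw [hPsum, map_one, one_mul]), one_mul]
  have sQ : ∑ k, Q k * E = E := by
    rw [← Finset.sum_mul, hcancel (Y := 1) (by rw [hQsum, map_one, one_mul]), one_mul]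
  have hc : ∀ j k, (P j * E - Q k * E) ^ 3 = (((d : ℂ) - 1) / d) • (P j * E - Q k * E) := by
    intro j k
    have e : Commute (P j - Q k) E := (cP j).sub_left (cQ k)
    have hE3 : E ^ 3 = E := by rw [pow_succ, pow_two, hE2, hE2]
    rw [← sub_mul, e.mul_pow, hE3, hcancel (hcub j k), smul_mul_assoc]
  have hc' : ∀ k j, (Q k * E - P j * E) ^ 3 = (((d : ℂ) - 1) / d) • (Q k * E - P j * E) := by
    intro k j
    rw [← neg_sub, Odd.neg_pow (by decide), hc, smul_neg]
  exact ⟨⟨hE, pP, pQ, mP, mQ, sP, sQ,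
    fun j k => smul_mul_mul_eq_of_pow_three hd pQ pP mQ mP sP hc' k j,
    fun j k => smul_mul_mul_eq_of_pow_three hd pP pQ mP mQ sQ hc j k⟩, cP, cQ⟩

/-- The Kraus operators of the extraction isometry: `√d q₀ pₖ` on the support, with the complement of
the support sent to the first level of `ℂ^d`. -/
def extractionKraus (E : K →L[ℂ] K) (p q : Fin d → K →L[ℂ] K) (o k : Fin d) : K →L[ℂ] K :=
  ((√(d : ℝ) : ℝ) : ℂ) • (q o * p k) + if k = o then 1 - E else 0

/-- The operator `K → ℂ^d ⊗ K` with the given Kraus operators. -/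
def extraction (E : K →L[ℂ] K) (p q : Fin d → K →L[ℂ] K) (o : Fin d) :
    K →L[ℂ] HTensor (EuclideanSpace ℂ (Fin d)) K :=
  ∑ k, tensorLeft (EuclideanSpace.single k (1 : ℂ)) ∘L extractionKraus E p q o k

variable {E : K →L[ℂ] K} {p q : Fin d → K →L[ℂ] K}

theorem IsMUBOn.sum_star_extractionKraus_mul (h : IsMUBOn E p q) (o : Fin d) :
    ∑ k, star (extractionKraus E p q o k) * extractionKraus E p q o k = 1 := by
  have hs : ((√(d : ℝ) : ℝ) : ℂ) * ((√(d : ℝ) : ℝ) : ℂ) = d := by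
    rw [← Complex.ofReal_mul, Real.mul_self_sqrt (by positivity)]; simp
  have hEq : E * q o = q o := by
    have := congrArg star (h.mulQ o)
    rwa [star_mul, h.projE.isSelfAdjoint.star_eq, (h.projQ o).isSelfAdjoint.star_eq] at this
  have hterm : ∀ k, star (extractionKraus E p q o k) * extractionKraus E p q o k =
      p k + if k = o then 1 - E else 0 := by
    intro k
    have h1 : star (if k = o then 1 - E else 0) = if k = o then 1 - E else 0 := by
      split_ifs
      · rw [star_sub, star_one, h.projE.isSelfAdjoint.star_eq]
      · exact star_zero _
    have h2 : (if k = o then 1 - E else 0) * q o = 0 := by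
      split_ifs
      · rw [sub_mul, one_mul, hEq, sub_self]
      · exact zero_mul _
    have h3 : q o * (if k = o then 1 - E else 0) = 0 := by
      split_ifs
      · rw [mul_sub, mul_one, h.mulQ, sub_self]
      · exact mul_zero _
    have h4 : (if k = o then 1 - E else 0) * (if k = o then 1 - E else 0) =
        if k = o then 1 - E else 0 := by
      split_ifs
      · exact h.projE.one_sub.isIdempotentElem.eq
      · exact mul_zero _
    have h5 : star ((√(d : ℝ) : ℝ) : ℂ) = ((√(d : ℝ) : ℝ) : ℂ) := Complex.conj_ofReal _
    rw [extractionKraus, star_add, star_smul, star_mul, h1, h5,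
      (h.projQ o).isSelfAdjoint.star_eq, (h.projP k).isSelfAdjoint.star_eq]
    generalize (if k = o then 1 - E else 0) = F at h2 h3 h4 ⊢
    have h6 : ((√(d : ℝ) : ℝ) : ℂ) • (p k * q o) * ((√(d : ℝ) : ℝ) : ℂ) • (q o * p k) = p k := by
      rw [smul_mul_assoc, mul_smul_comm, smul_smul, hs, ← mul_assoc, mul_assoc (p k) (q o),
        (h.projQ o).isIdempotentElem.eq, h.unbiasedP]
    have h7 : ((√(d : ℝ) : ℝ) : ℂ) • (p k * q o) * F = 0 := by
      rw [smul_mul_assoc, mul_assoc, h3, mul_zero, smul_zero]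
    have h8 : F * ((√(d : ℝ) : ℝ) : ℂ) • (q o * p k) = 0 := by
      rw [mul_smul_comm, ← mul_assoc, h2, zero_mul, smul_zero]
    rw [add_mul, mul_add, mul_add, h4, h6, h7, h8, add_zero, zero_add]
  simp only [hterm, Finset.sum_add_distrib, h.sumP]
  simp

theorem IsMUBOn.adjoint_extraction_comp (h : IsMUBOn E p q) (o : Fin d) :
    (extraction E p q o).adjoint ∘L extraction E p q o = 1 := by
  rw [← h.sum_star_extractionKraus_mul o, extraction, map_sum, ContinuousLinearMap.finsetSum_comp]
  refine Finset.sum_congr rfl fun k _ => ?_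
  rw [ContinuousLinearMap.comp_finsetSum]
  have hterm : ∀ l, (tensorLeft (EuclideanSpace.single k (1 : ℂ)) ∘L
      extractionKraus E p q o k).adjoint ∘L (tensorLeft (EuclideanSpace.single l (1 : ℂ)) ∘L
        extractionKraus E p q o l) =
      if k = l then star (extractionKraus E p q o k) * extractionKraus E p q o k else 0 := by
    intro l
    rw [ContinuousLinearMap.adjoint_comp, ContinuousLinearMap.comp_assoc,
      ← ContinuousLinearMap.comp_assoc _ _ (extractionKraus E p q o l), adjoint_tensorLeft_comp]
    split_ifs with hkl
    · subst hkl; simp; rfl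
    · ext x; simp [EuclideanSpace.inner_single_left, hkl]
  rw [Finset.sum_congr rfl fun l _ => hterm l]
  simp

/-- The extraction isometry. -/
def IsMUBOn.isometry (h : IsMUBOn E p q) (o : Fin d) :
    K →ₗᵢ[ℂ] HTensor (EuclideanSpace ℂ (Fin d)) K where
  toLinearMap := (extraction E p q o : K →ₗ[ℂ] HTensor (EuclideanSpace ℂ (Fin d)) K)
  norm_map' := (ContinuousLinearMap.norm_map_iff_adjoint_comp_self _).2
    (h.adjoint_extraction_comp o)

end MUB

/-! ### Extraction of the maximally entangled state -/

section SelfTest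

variable {d : ℕ} {HA HB : Type*}
  [NormedAddCommGroup HA] [InnerProductSpace ℂ HA] [CompleteSpace HA]
  [NormedAddCommGroup HB] [InnerProductSpace ℂ HB] [CompleteSpace HB]

theorem adjoint_opTensor_comp_self {H H' K K' : Type*}
    [NormedAddCommGroup H] [InnerProductSpace ℂ H] [CompleteSpace H]
    [NormedAddCommGroup H'] [InnerProductSpace ℂ H'] [CompleteSpace H']
    [NormedAddCommGroup K] [InnerProductSpace ℂ K] [CompleteSpace K]
    [NormedAddCommGroup K'] [InnerProductSpace ℂ K'] [CompleteSpace K']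
    {S : H →L[ℂ] H'} {T : K →L[ℂ] K'} (hS : S.adjoint ∘L S = 1) (hT : T.adjoint ∘L T = 1) :
    (opTensor S T).adjoint ∘L opTensor S T = 1 := by
  rw [adjoint_opTensor, opTensor_comp, hS, hT, opTensor_one_one]

variable (d HA HB) in
theorem adjoint_adjoinMaxEnt_comp_self (hd : 0 < d) :
    (adjoinMaxEnt d HA HB).adjoint ∘L adjoinMaxEnt d HA HB = 1 := by
  have hterm : ∀ k l : Fin d,
      (opTensor (tensorLeft (K := HA) (EuclideanSpace.single k (1 : ℂ)))
        (tensorLeft (K := HB) (EuclideanSpace.single k (1 : ℂ)))).adjoint ∘L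
      opTensor (tensorLeft (K := HA) (EuclideanSpace.single l (1 : ℂ)))
        (tensorLeft (K := HB) (EuclideanSpace.single l (1 : ℂ))) = if k = l then 1 else 0 := by
    intro k l
    rw [adjoint_opTensor, opTensor_comp, adjoint_tensorLeft_comp, adjoint_tensorLeft_comp]
    split_ifs with hkl
    · subst hkl; simp [opTensor_one_one]
    · simp [EuclideanSpace.inner_single_left, hkl, opTensor_zero_left]
  have hs : ((1 / √(d : ℝ) : ℝ) : ℂ) * ((1 / √(d : ℝ) : ℝ) : ℂ) * d = 1 := by
    have : (1 / √(d : ℝ)) * (1 / √(d : ℝ)) * d = 1 := by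
      have : (0 : ℝ) < d := by exact_mod_cast hd
      rw [div_mul_div_comm, one_mul, Real.mul_self_sqrt this.le, one_div_mul_cancel this.ne']
    exact_mod_cast this
  rw [adjoinMaxEnt, map_smulₛₗ, map_sum, ContinuousLinearMap.smul_comp,
    ContinuousLinearMap.comp_smul, ContinuousLinearMap.finsetSum_comp, smul_smul]
  simp only [ContinuousLinearMap.comp_finsetSum, hterm]
  simp only [Finset.sum_ite_eq, Finset.mem_univ, if_true, Finset.sum_const, Finset.card_univ,
    Fintype.card_fin, ← Nat.cast_smul_eq_nsmul ℂ, smul_smul, Complex.conj_ofReal, hs, one_smul]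

/-- The product of two of the Kraus operators acts on the state as zero, or as `q` for equal indices,
because Alice's operators can be replaced by Bob's in the reverse order. -/
theorem opTensor_extractionKraus_mul {EA : HA →L[ℂ] HA} {EB : HB →L[ℂ] HB}
    {pA qA : Fin d → HA →L[ℂ] HA} {pB qB : Fin d → HB →L[ℂ] HB}
    (hB : IsMUBOn EB pB qB) {σ : HTensor HA HB →L[ℂ] HTensor HA HB}
    (hEA : aliceHom HA HB EA * σ = σ) (hEB : bobHom HA HB EB * σ = σ)
    (hp : ∀ j, aliceHom HA HB (pA j) * σ = bobHom HA HB (pB j) * σ)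
    (hq : ∀ k, aliceHom HA HB (qA k) * σ = bobHom HA HB (qB k) * σ) (o j k : Fin d) :
    opTensor (extractionKraus EA pA qA o j) (extractionKraus EB pB qB o k) * σ =
      if j = k then bobHom HA HB (qB o) * σ else 0 := by
  have hs : ((√(d : ℝ) : ℝ) : ℂ) * ((√(d : ℝ) : ℝ) : ℂ) = d := by
    rw [← Complex.ofReal_mul, Real.mul_self_sqrt (by positivity)]; simp
  have hcomm : ∀ S T, aliceHom HA HB S * bobHom HA HB T = bobHom HA HB T * aliceHom HA HB S :=
    fun S T => (aliceHom_commute_bobHom S T).eq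
  have kB : ∀ k, bobHom HA HB (extractionKraus EB pB qB o k) * σ =
      ((√(d : ℝ) : ℝ) : ℂ) • (bobHom HA HB (qB o * pB k) * σ) := by
    intro k
    have h0 : bobHom HA HB (if k = o then 1 - EB else 0) * σ = 0 := by
      split_ifs
      · rw [map_sub, map_one, sub_mul, one_mul, hEB, sub_self]
      · rw [map_zero, zero_mul]
    rw [extractionKraus, map_add, add_mul, h0, add_zero, map_smul, smul_mul_assoc]
  have kA : ∀ k, aliceHom HA HB (extractionKraus EA pA qA o k) * σ =
      ((√(d : ℝ) : ℝ) : ℂ) • (bobHom HA HB (pB k * qB o) * σ) := by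
    intro k
    have h0 : aliceHom HA HB (if k = o then 1 - EA else 0) * σ = 0 := by
      split_ifs
      · rw [map_sub, map_one, sub_mul, one_mul, hEA, sub_self]
      · rw [map_zero, zero_mul]
    rw [extractionKraus, map_add, add_mul, h0, add_zero, map_smul, smul_mul_assoc, map_mul,
      mul_assoc, hp, ← mul_assoc, hcomm, mul_assoc, hq, ← mul_assoc, map_mul]
  rw [← aliceHom_mul_bobHom, mul_assoc, kB, mul_smul_comm, ← mul_assoc, hcomm, mul_assoc, kA,
    mul_smul_comm, smul_smul, hs, ← mul_assoc, ← map_mul]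
  have e : qB o * pB k * (pB j * qB o) = qB o * (pB k * pB j) * qB o := by
    simp only [mul_assoc]
  rw [e]
  split_ifs with hjk
  · subst hjk
    rw [(hB.projP j).isIdempotentElem.eq, ← smul_mul_assoc, ← map_smul, hB.unbiasedQ]
  · rw [mul_eq_zero_of_sum_eq_projection hB.projP hB.mulP hB.sumP (Ne.symm hjk), mul_zero,
      zero_mul, map_zero, zero_mul, smul_zero]

omit [CompleteSpace HA] [CompleteSpace HB] in
theorem adjoinMaxEnt_comp_smul (hd : 0 < d) {H : Type*} [NormedAddCommGroup H]
    [InnerProductSpace ℂ H] (X : H →L[ℂ] HTensor HA HB) :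
    adjoinMaxEnt d HA HB ∘L (((√(d : ℝ) : ℝ) : ℂ) • X) =
      ∑ k : Fin d, opTensor (tensorLeft (K := HA) (EuclideanSpace.single k (1 : ℂ)))
        (tensorLeft (K := HB) (EuclideanSpace.single k (1 : ℂ))) ∘L X := by
  have hd' : (0 : ℝ) < d := by exact_mod_cast hd
  have hs : ((√(d : ℝ) : ℝ) : ℂ) * ((1 / √(d : ℝ) : ℝ) : ℂ) = 1 := by
    rw [← Complex.ofReal_mul, mul_one_div_cancel (by positivity), Complex.ofReal_one]
  ext x
  simp only [adjoinMaxEnt, ContinuousLinearMap.comp_apply, smul_apply, map_smul, smul_smul, hs,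
    one_smul, sum_apply]

/-- The local isometries map the square root of the state to `Φ ⊗ (√d (1 ⊗ q) σ)`. -/
theorem opTensor_extraction_mul {EA : HA →L[ℂ] HA} {EB : HB →L[ℂ] HB}
    {pA qA : Fin d → HA →L[ℂ] HA} {pB qB : Fin d → HB →L[ℂ] HB}
    (hB : IsMUBOn EB pB qB) {σ : HTensor HA HB →L[ℂ] HTensor HA HB}
    (hEA : aliceHom HA HB EA * σ = σ) (hEB : bobHom HA HB EB * σ = σ)
    (hp : ∀ j, aliceHom HA HB (pA j) * σ = bobHom HA HB (pB j) * σ)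
    (hq : ∀ k, aliceHom HA HB (qA k) * σ = bobHom HA HB (qB k) * σ) (o : Fin d) :
    opTensor (extraction EA pA qA o) (extraction EB pB qB o) ∘L σ =
      adjoinMaxEnt d HA HB ∘L (((√(d : ℝ) : ℝ) : ℂ) • (bobHom HA HB (qB o) * σ)) := by
  have hterm : ∀ j k, opTensor
      (tensorLeft (EuclideanSpace.single j (1 : ℂ)) ∘L extractionKraus EA pA qA o j)
      (tensorLeft (EuclideanSpace.single k (1 : ℂ)) ∘L extractionKraus EB pB qB o k) ∘L σ =
      if j = k then opTensor (tensorLeft (EuclideanSpace.single j (1 : ℂ)))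
        (tensorLeft (EuclideanSpace.single j (1 : ℂ))) ∘L (bobHom HA HB (qB o) * σ) else 0 := by
    intro j k
    rw [← opTensor_comp, ContinuousLinearMap.comp_assoc, ← ContinuousLinearMap.mul_def,
      opTensor_extractionKraus_mul hB hEA hEB hp hq]
    split_ifs with hjk
    · rw [hjk]
    · rw [ContinuousLinearMap.comp_zero]
  rw [adjoinMaxEnt_comp_smul o.pos, extraction, extraction, opTensor_sum_left,
    ContinuousLinearMap.finsetSum_comp]
  refine Finset.sum_congr rfl fun j _ => ?_
  rw [opTensor_sum_right, ContinuousLinearMap.finsetSum_comp,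
    Finset.sum_congr rfl fun k _ => hterm j k, Finset.sum_ite_eq, if_pos (Finset.mem_univ j)]

/-- If isometries `W` and `J` satisfy `W σ = J T` for the square root `σ` of a state `ρ`, then `T T*` is a
state, and its image under `J` is the image of `ρ` under `W`. -/
theorem isDensityOperator_comp_adjoint {H H' : Type*}
    [NormedAddCommGroup H] [InnerProductSpace ℂ H] [CompleteSpace H]
    [NormedAddCommGroup H'] [InnerProductSpace ℂ H'] [CompleteSpace H']
    {ρ : H →L[ℂ] H} (hρ : IsDensityOperator ρ) {W J : H →L[ℂ] H'} {T : H →L[ℂ] H}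
    (hW : W.adjoint ∘L W = 1) (hJ : J.adjoint ∘L J = 1) (h : W ∘L hρ.root = J ∘L T) :
    IsDensityOperator (T ∘L T.adjoint) ∧
      W ∘L ρ ∘L W.adjoint = J ∘L (T ∘L T.adjoint) ∘L J.adjoint := by
  have hW' := (ContinuousLinearMap.norm_map_iff_adjoint_comp_self W).2 hW
  have hJ' := (ContinuousLinearMap.norm_map_iff_adjoint_comp_self J).2 hJ
  have hn : ∀ x, ‖T x‖ = ‖hρ.root x‖ := fun x => by
    have := congrArg (fun f => ‖f x‖) h
    simpa [hW', hJ'] using this.symm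
  refine ⟨⟨ContinuousLinearMap.isPositive_self_comp_adjoint T, ?_⟩, ?_⟩
  · have h1 : HasSum (fun i => ‖T (basis H i)‖ ^ 2) 1 := by
      simpa only [hn] using hρ.hasSum_norm_sq_root
    have h2 := Complex.hasSum_ofReal.2 (hasSum_norm_sq_adjoint _ h1)
    rw [Complex.ofReal_one] at h2
    convert h2 using 2 with i
    rw [ContinuousLinearMap.comp_apply, ← ContinuousLinearMap.adjoint_inner_left,
      inner_self_eq_norm_sq_to_K]
    norm_cast
  · have h1 : W ∘L ρ ∘L W.adjoint = (W ∘L hρ.root) ∘L (W ∘L hρ.root).adjoint := by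
      rw [ContinuousLinearMap.adjoint_comp, hρ.adjoint_root]
      ext x
      simp [hρ.root_apply_root]
    rw [h1, h, ContinuousLinearMap.adjoint_comp]
    rfl

namespace Realisation

variable {R : Realisation d HA HB} {t : ℝ}

/-- An optimal realisation has mutually unbiased measurements on both local supports, which agree on
the state. -/
theorem exists_isMUBOn (ht : 0 < t) (htd : √(((d : ℝ) - 1) / d) = t) (hd : 0 < d)
    (hR : ((d : ℝ) - 1) / t ≤ R.bellValue) :
    ∃ (EA : HA →L[ℂ] HA) (EB : HB →L[ℂ] HB) (pA qA : Fin d → HA →L[ℂ] HA),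
      IsMUBOn EA pA qA ∧
      IsMUBOn EB (fun j => (R.bob 0).effect j * EB) (fun k => (R.bob 1).effect k * EB) ∧
      aliceHom HA HB EA * R.isDensity.root = R.isDensity.root ∧
      bobHom HA HB EB * R.isDensity.root = R.isDensity.root ∧
      (∀ j, aliceHom HA HB (pA j) * R.isDensity.root =
        bobHom HA HB ((R.bob 0).effect j * EB) * R.isDensity.root) ∧
      ∀ k, aliceHom HA HB (qA k) * R.isDensity.root =
        bobHom HA HB ((R.bob 1).effect k * EB) * R.isDensity.root := by
  set σ := R.isDensity.root
  obtain ⟨EA, hEA, hEAσ, hEAs⟩ := exists_supportAlice σ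
  obtain ⟨EB, hEB, hEBσ, hEBs⟩ := exists_supportBob σ
  have hcopy : ∀ y b, aliceHom HA HB (R.aliceCopy t y b) * σ = R.bobEffect y b * σ :=
    aliceCopy_mul_root ht htd hd hR
  have hBB : ∀ y b, R.bobEffect y b * R.bobEffect y b * σ = R.bobEffect y b * σ :=
    bobEffect_mul_bobEffect_mul_root ht htd hd hR
  have hd' : (d : ℝ) ≠ 0 := by exact_mod_cast hd.ne'
  have hd1 : (1 : ℝ) ≤ d := by exact_mod_cast hd
  have ht2 : (t : ℂ) ^ 2 = ((d : ℂ) - 1) / d := by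
    have : t ^ 2 = ((d : ℝ) - 1) / d := by
      rw [← htd, Real.sq_sqrt (div_nonneg (by linarith) (by linarith))]
    exact_mod_cast this
  have hcub : ∀ j k, (R.bobEffect 0 j - R.bobEffect 1 k) ^ 3 * σ =
      (((d : ℂ) - 1) / d) • (R.bobEffect 0 j - R.bobEffect 1 k) * σ := by
    intro j k
    rw [← ht2]
    exact bobDiff_pow_three_mul_root ht htd hd hR j k
  have hcomm : ∀ S y b, Commute (aliceHom HA HB S) (R.bobEffect y b) := fun S y b =>
    aliceHom_commute_bobHom _ _
  have hB := isMUBOn_support hd hEB hEBσ hEBs (P := (R.bob 0).effect) (Q := (R.bob 1).effect)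
    (R.bob 0).isSelfAdjoint (R.bob 1).isSelfAdjoint
    (P' := fun j => aliceHom HA HB (R.aliceCopy t 0 j))
    (Q' := fun j => aliceHom HA HB (R.aliceCopy t 1 j))
    (fun j X => aliceHom_commute_bobHom _ _) (fun j X => aliceHom_commute_bobHom _ _)
    (hcopy 0) (hcopy 1) (fun j => by rw [map_mul]; exact hBB 0 j)
    (fun j => by rw [map_mul]; exact hBB 1 j)
    (by rw [(R.bob 0).sum_effect, map_one, one_mul])
    (by rw [(R.bob 1).sum_effect, map_one, one_mul])
    (fun j k => by rw [map_pow, map_smul, map_sub]; exact hcub j k)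
  have hAA : ∀ y b, aliceHom HA HB (R.aliceCopy t y b * R.aliceCopy t y b) * σ =
      aliceHom HA HB (R.aliceCopy t y b) * σ := fun y b => by
    rw [map_mul, ← pow_two, pow_mul_eq_pow_mul_of_commute (hcomm _ y b) (hcopy y b), pow_two, hBB,
      hcopy]
  have hAsum : ∀ y, aliceHom HA HB (∑ b, R.aliceCopy t y b) * σ = σ := fun y => by
    rw [map_sum, Finset.sum_mul, Finset.sum_congr rfl fun b _ => hcopy y b, ← Finset.sum_mul,
      R.sum_bobEffect, one_mul]
  have hA := isMUBOn_support hd hEA hEAσ hEAs (P := R.aliceCopy t 0) (Q := R.aliceCopy t 1)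
    (R.aliceCopy_isSelfAdjoint t 0) (R.aliceCopy_isSelfAdjoint t 1)
    (P' := R.bobEffect 0) (Q' := R.bobEffect 1)
    (fun j X => (hcomm _ _ _).symm) (fun j X => (hcomm _ _ _).symm)
    (fun j => (hcopy 0 j).symm) (fun j => (hcopy 1 j).symm) (hAA 0) (hAA 1) (hAsum 0) (hAsum 1)
    (fun j k => by
      have h1 : aliceHom HA HB (R.aliceCopy t 0 j - R.aliceCopy t 1 k) * σ =
          (R.bobEffect 0 j - R.bobEffect 1 k) * σ := by
        rw [map_sub, sub_mul, sub_mul, hcopy, hcopy]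
      rw [map_pow, pow_mul_eq_pow_mul_of_commute ((hcomm _ _ _).sub_right (hcomm _ _ _)) h1, hcub,
        map_smul, smul_mul_assoc, smul_mul_assoc, h1])
  have hloc : ∀ y b, aliceHom HA HB (R.aliceCopy t y b * EA) * σ =
      bobHom HA HB ((R.bob y).effect b * EB) * σ := fun y b => by
    rw [map_mul, mul_assoc, hEAσ, hcopy, map_mul, mul_assoc, hEBσ]; rfl
  exact ⟨EA, EB, _, _, hA.1, hB.1, hEAσ, hEBσ, hloc 0, hloc 1⟩

end Realisation

end SelfTest

/-! ### A realisation attaining the quantum bound -/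

section Construction

open InnerProductSpace (rankOne)

variable {H : Type*} [NormedAddCommGroup H] [InnerProductSpace ℂ H] {d : ℕ}

/-- The difference of two basis projections with unbiased vectors is a tripotent up to scaling. -/
theorem rankOne_sub_rankOne_pow_three {e f : H} (he : ‖e‖ = 1) (hf : ‖f‖ = 1)
    (hef : ⟪e, f⟫_ℂ * ⟪f, e⟫_ℂ = 1 / d) :
    (rankOne ℂ e e - rankOne ℂ f f) ^ 3 =
      (1 - 1 / d : ℂ) • (rankOne ℂ e e - rankOne ℂ f f : H →L[ℂ] H) := by
  have hee : ⟪e, e⟫_ℂ = 1 := by rw [inner_self_eq_norm_sq_to_K, he]; simp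
  have hff : ⟪f, f⟫_ℂ = 1 := by rw [inner_self_eq_norm_sq_to_K, hf]; simp
  have h1 : rankOne ℂ e e * rankOne ℂ e e = rankOne ℂ e e := by
    rw [ContinuousLinearMap.mul_def, InnerProductSpace.rankOne_comp_rankOne, hee, one_smul]
  have h2 : rankOne ℂ f f * rankOne ℂ f f = rankOne ℂ f f := by
    rw [ContinuousLinearMap.mul_def, InnerProductSpace.rankOne_comp_rankOne, hff, one_smul]
  have h3 : rankOne ℂ e e * rankOne ℂ f f * rankOne ℂ e e = (1 / d : ℂ) • rankOne ℂ e e := by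
    ext x
    simp only [mul_apply_eq_comp, InnerProductSpace.rankOne_apply, inner_smul_right, smul_smul,
      smul_apply, ← hef]
    congr 1; ring
  have h4 : rankOne ℂ f f * rankOne ℂ e e * rankOne ℂ f f = (1 / d : ℂ) • rankOne ℂ f f := by
    ext x
    simp only [mul_apply_eq_comp, InnerProductSpace.rankOne_apply, inner_smul_right, smul_smul,
      smul_apply, ← hef]
    congr 1; ring
  generalize rankOne ℂ e e = P at h1 h3 h4 ⊢
  generalize rankOne ℂ f f = Q at h2 h3 h4 ⊢
  have e1 : (P - Q) ^ 3 = P * P * P - P * P * Q - P * Q * P + P * (Q * Q) - Q * (P * P) +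
      Q * P * Q + Q * Q * P - Q * Q * Q := by noncomm_ring
  rw [e1, h1, h2, h1, h2, h3, h4]
  module

variable [CompleteSpace H]

/-- The measurement in an orthonormal basis. -/
def POVM.ofBasis (b : OrthonormalBasis (Fin d) ℂ H) : POVM (Fin d) H where
  effect i := rankOne ℂ (b i) (b i)
  isPositive _ := InnerProductSpace.isPositive_rankOne_self _
  sum_effect := b.sum_rankOne_eq_id

theorem POVM.ofBasis_isStarProjection (b : OrthonormalBasis (Fin d) ℂ H) (i : Fin d) :
    IsStarProjection ((POVM.ofBasis b).effect i) :=
  InnerProductSpace.isStarProjection_rankOne_self (b.orthonormal.1 i)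

/-- For a self-adjoint `Z` with `Z³ = Z`, the measurement of `Z` with outcomes `1`, `-1` and `0`. -/
def POVM.ofTripotent (Z : H →L[ℂ] H) (hZ : IsSelfAdjoint Z) (hZ3 : Z ^ 3 = Z) :
    POVM (Option (Fin 2)) H where
  effect a := match a with
    | some 0 => (1 / 2 : ℂ) • (Z * Z + Z)
    | some 1 => (1 / 2 : ℂ) • (Z * Z - Z)
    | none => 1 - Z * Z
  isPositive a := by
    have h4 : Z * Z * (Z * Z) = Z * Z := by
      calc Z * Z * (Z * Z) = Z ^ 3 * Z := by noncomm_ring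
        _ = Z * Z := by rw [hZ3]
    have h3 : Z * (Z * Z) = Z := by
      calc Z * (Z * Z) = Z ^ 3 := by noncomm_ring
        _ = Z := hZ3
    have h3' : Z * Z * Z = Z := by rw [mul_assoc, h3]
    have hsq : IsSelfAdjoint (Z * Z) := by rw [IsSelfAdjoint, star_mul, hZ.star_eq]
    have hc : IsSelfAdjoint (1 / 2 : ℂ) := by simp [isSelfAdjoint_iff]
    match a with
    | some 0 =>
      refine ContinuousLinearMap.IsPositive.of_isStarProjection ⟨?_, hc.smul (hsq.add hZ)⟩
      change (1 / 2 : ℂ) • (Z * Z + Z) * (1 / 2 : ℂ) • (Z * Z + Z) = (1 / 2 : ℂ) • (Z * Z + Z)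
      rw [smul_mul_assoc, mul_smul_comm, mul_add, add_mul, add_mul, h4, h3, h3']
      module
    | some 1 =>
      refine ContinuousLinearMap.IsPositive.of_isStarProjection ⟨?_, hc.smul (hsq.sub hZ)⟩
      change (1 / 2 : ℂ) • (Z * Z - Z) * (1 / 2 : ℂ) • (Z * Z - Z) = (1 / 2 : ℂ) • (Z * Z - Z)
      rw [smul_mul_assoc, mul_smul_comm, mul_sub, sub_mul, sub_mul, h4, h3, h3']
      module
    | none =>
      refine ContinuousLinearMap.IsPositive.of_isStarProjection
        ⟨?_, (IsSelfAdjoint.one _).sub hsq⟩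
      change (1 - Z * Z) * (1 - Z * Z) = 1 - Z * Z
      rw [mul_sub, mul_one, sub_mul, one_mul, h4, sub_self, sub_zero]
  sum_effect := by
    rw [Fintype.sum_option, Fin.sum_univ_two]
    module

theorem POVM.ofTripotent_diff (Z : H →L[ℂ] H) (hZ : IsSelfAdjoint Z) (hZ3 : Z ^ 3 = Z) :
    (POVM.ofTripotent Z hZ hZ3).diff = Z := by
  change (1 / 2 : ℂ) • (Z * Z + Z) - (1 / 2 : ℂ) • (Z * Z - Z) = Z
  module

theorem POVM.ofTripotent_conclusive (Z : H →L[ℂ] H) (hZ : IsSelfAdjoint Z) (hZ3 : Z ^ 3 = Z) :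
    (POVM.ofTripotent Z hZ hZ3).conclusive = Z * Z := by
  change (1 / 2 : ℂ) • (Z * Z + Z) + (1 / 2 : ℂ) • (Z * Z - Z) = Z * Z
  module

theorem isDensityOperator_rankOne {Φ : H} (hΦ : ‖Φ‖ = 1) : IsDensityOperator (rankOne ℂ Φ Φ) where
  isPositive := InnerProductSpace.isPositive_rankOne_self _
  hasSum_trace := by
    have h := (basis H).hasSum_inner_mul_inner Φ Φ
    rw [inner_self_eq_norm_sq_to_K, hΦ] at h
    simpa [inner_smul_right] using h

variable {HA HB : Type*}
  [NormedAddCommGroup HA] [InnerProductSpace ℂ HA] [CompleteSpace HA]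
  [NormedAddCommGroup HB] [InnerProductSpace ℂ HB] [CompleteSpace HB]

/-- Bob measures in two mutually unbiased bases, Alice measures the corresponding tripotents for her
own pair of bases, on a pure state which matches Alice's bases with Bob's. -/
theorem exists_realisation_bellValue {t : ℝ} (ht : 0 < t) (htd : √(((d : ℝ) - 1) / d) = t)
    (hd : 1 < d) (eA fA : OrthonormalBasis (Fin d) ℂ HA) (eB fB : OrthonormalBasis (Fin d) ℂ HB)
    (hA : ∀ j k, ⟪eA j, fA k⟫_ℂ * ⟪fA k, eA j⟫_ℂ = 1 / d) {Φ : HTensor HA HB} (hΦ : ‖Φ‖ = 1)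
    (he : ∀ j, aliceHom HA HB (rankOne ℂ (eA j) (eA j)) Φ =
      bobHom HA HB (rankOne ℂ (eB j) (eB j)) Φ)
    (hf : ∀ k, aliceHom HA HB (rankOne ℂ (fA k) (fA k)) Φ =
      bobHom HA HB (rankOne ℂ (fB k) (fB k)) Φ) :
    ∃ R : Realisation d HA HB, R.bellValue = ((d : ℝ) - 1) / t := by
  have hd' : (0 : ℝ) < d := by exact_mod_cast hd.le.trans_lt' one_pos
  have hd1 : (1 : ℝ) < d := by exact_mod_cast hd
  have htc : (t : ℂ) ≠ 0 := Complex.ofReal_ne_zero.2 ht.ne'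
  have ht2 : (1 - 1 / d : ℂ) = (t : ℂ) ^ 2 := by
    have : t ^ 2 = 1 - 1 / (d : ℝ) := by
      rw [← htd, Real.sq_sqrt (div_nonneg (by linarith) (by linarith))]
      field_simp
    have h2 : ((t ^ 2 : ℝ) : ℂ) = ((1 - 1 / (d : ℝ) : ℝ) : ℂ) := by rw [this]
    push_cast at h2
    exact h2.symm
  set Z : (Fin 2 → Fin d) → HA →L[ℂ] HA := fun x => ((1 / t : ℝ) : ℂ) •
    (rankOne ℂ (eA (x 0)) (eA (x 0)) - rankOne ℂ (fA (x 1)) (fA (x 1))) with hZdef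
  have hZ : ∀ x, IsSelfAdjoint (Z x) := fun x =>
    IsSelfAdjoint.smul (Complex.conj_ofReal _)
      ((InnerProductSpace.isPositive_rankOne_self _).isSelfAdjoint.sub
        (InnerProductSpace.isPositive_rankOne_self _).isSelfAdjoint)
  have hZ3 : ∀ x, Z x ^ 3 = Z x := by
    intro x
    simp only [hZdef]
    rw [smul_pow, rankOne_sub_rankOne_pow_three (eA.orthonormal.1 _) (fA.orthonormal.1 _) (hA _ _),
      smul_smul, ht2]
    congr 1
    push_cast
    field_simp
  set R : Realisation d HA HB :=
    { state := rankOne ℂ Φ Φ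
      isDensity := isDensityOperator_rankOne hΦ
      alice := fun x => POVM.ofTripotent (Z x) (hZ x) (hZ3 x)
      bob := fun y => if y = 0 then POVM.ofBasis eB else POVM.ofBasis fB } with hRdef
  refine ⟨R, ?_⟩
  have hb0 : ∀ j, R.bobEffect 0 j = bobHom HA HB (rankOne ℂ (eB j) (eB j)) := fun j => rfl
  have hb1 : ∀ k, R.bobEffect 1 k = bobHom HA HB (rankOne ℂ (fB k) (fB k)) := fun j => rfl
  have hd0 : ∀ j k, R.aliceDiff j k = aliceHom HA HB (Z ![j, k]) := fun j k => by
    rw [Realisation.aliceDiff]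
    exact congrArg _ (POVM.ofTripotent_diff _ (hZ _) (hZ3 _))
  have hc0 : ∀ j k, R.aliceConclusive j k = aliceHom HA HB (Z ![j, k] * Z ![j, k]) := fun j k => by
    rw [Realisation.aliceConclusive]
    exact congrArg _ (POVM.ofTripotent_conclusive _ (hZ _) (hZ3 _))
  have hkill : ∀ j k, ((t : ℂ) • R.aliceDiff j k - (R.bobEffect 0 j - R.bobEffect 1 k)) Φ = 0 := by
    intro j k
    have h1 : (t : ℂ) • R.aliceDiff j k = aliceHom HA HB
        (rankOne ℂ (eA j) (eA j) - rankOne ℂ (fA k) (fA k)) := by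
      rw [hd0, ← map_smul]
      congr 1
      simp only [hZdef, smul_smul]
      rw [← Complex.ofReal_mul, mul_one_div_cancel ht.ne']
      simp
    rw [h1, hb0, hb1, map_sub]
    simp only [sub_apply, he, hf, sub_self]
  rw [← sub_eq_zero, ← neg_sub, neg_eq_zero, R.bound_sub_bellValue t ht htd]
  have h1 : ∀ j k, R.aliceConclusive j k - R.aliceDiff j k * R.aliceDiff j k = 0 := fun j k => by
    rw [hc0, hd0, map_mul, sub_self]
  have h2 : ∀ j k, R.isDensity.expect
      (((t : ℂ) • R.aliceDiff j k - (R.bobEffect 0 j - R.bobEffect 1 k)) *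
        ((t : ℂ) • R.aliceDiff j k - (R.bobEffect 0 j - R.bobEffect 1 k))) = 0 := fun j k => by
    refine R.isDensity.expect_eq_zero_of_mul_eq_zero ?_ ?_
    · ext x
      have : R.state x = ⟪Φ, x⟫_ℂ • Φ := rfl
      rw [mul_apply_eq_comp, mul_apply_eq_comp, this, map_smul, hkill, smul_zero, map_zero]
      rfl
    · exact IsSelfAdjoint.of_nonneg (R.smul_aliceDiff_sub_mul_self_nonneg t j k)
  have h3 : ∀ y b, R.bobEffect y b - R.bobEffect y b * R.bobEffect y b = 0 := fun y b => by
    have : IsIdempotentElem ((R.bob y).effect b) := by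
      by_cases hy : y = 0
      · simp only [hRdef, if_pos hy]
        exact (POVM.ofBasis_isStarProjection eB b).isIdempotentElem
      · simp only [hRdef, if_neg hy]
        exact (POVM.ofBasis_isStarProjection fB b).isIdempotentElem
    rw [Realisation.bobEffect, ← map_mul, this.eq, sub_self]
  simp only [h1, h2, h3, map_zero, Complex.zero_re, mul_zero, add_zero, Finset.sum_const_zero]

end Construction

section Fourier

/-- The vector with the given coordinates, in a `d`-dimensional Hilbert space of arbitrary universe. -/
def levelVec {d : ℕ} (c : Fin d → ℂ) : EuclideanSpace ℂ (ULift.{u} (Fin d)) :=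
  WithLp.toLp 2 fun i => c i.down

variable {d : ℕ}

theorem inner_levelVec (c c' : Fin d → ℂ) :
    ⟪levelVec.{u} c, levelVec.{u} c'⟫_ℂ = ∑ j, starRingEnd ℂ (c j) * c' j := by
  rw [PiLp.inner_apply, ← Equiv.sum_comp Equiv.ulift.symm]
  refine Finset.sum_congr rfl fun j _ => ?_
  simp [levelVec, mul_comm]

theorem levelVec_eq_sum (c : Fin d → ℂ) :
    levelVec.{u} c = ∑ j, c j • levelVec.{u} (Pi.single j 1) := by
  ext i
  simp [levelVec, Pi.single_apply]

/-- The rows of a matrix with orthonormal rows, as an orthonormal basis. -/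
theorem exists_basis_levelVec {U : Fin d → Fin d → ℂ}
    (hU : ∀ k l, ∑ j, starRingEnd ℂ (U k j) * U l j = if k = l then 1 else 0) :
    ∃ b : OrthonormalBasis (Fin d) ℂ (EuclideanSpace ℂ (ULift.{u} (Fin d))),
      ∀ k, b k = levelVec (U k) := by
  have hon : Orthonormal ℂ fun k => levelVec.{u} (U k) := by
    rw [orthonormal_iff_ite]
    intro k l
    rw [inner_levelVec, hU]
  have hcard : Fintype.card (Fin d) =
      Module.finrank ℂ (EuclideanSpace ℂ (ULift.{u} (Fin d))) := by simp
  exact ⟨OrthonormalBasis.mk hon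
    (hon.linearIndependent.span_eq_top_of_card_eq_finrank' hcard).ge, fun k => by simp⟩

/-- The unnormalised maximally entangled vector. -/
def maxEntVec (d : ℕ) :
    HTensor (EuclideanSpace ℂ (ULift.{u} (Fin d))) (EuclideanSpace ℂ (ULift.{v} (Fin d))) :=
  ∑ j, tensorLeft (levelVec.{u} (Pi.single j 1)) (levelVec.{v} (Pi.single j 1))

theorem tensorLeft_sum {H K ι : Type*} [NormedAddCommGroup H] [InnerProductSpace ℂ H]
    [NormedAddCommGroup K] [InnerProductSpace ℂ K] (s : Finset ι) (f : ι → H) (b : K) :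
    tensorLeft (∑ i ∈ s, f i) b = ∑ i ∈ s, tensorLeft (f i) b := by
  simp [tensorLeft]

/-- The transposition property of the maximally entangled vector: projecting Bob's system onto a
vector has the same effect as projecting Alice's onto the conjugate vector. -/
theorem alice_rankOne_maxEntVec (c : Fin d → ℂ) :
    aliceHom _ _ (InnerProductSpace.rankOne ℂ (levelVec.{u} (star c)) (levelVec.{u} (star c)))
        (maxEntVec.{u, v} d) =
      bobHom _ _ (InnerProductSpace.rankOne ℂ (levelVec.{v} c) (levelVec.{v} c))
        (maxEntVec.{u, v} d) := by
  have hl : aliceHom _ _ (InnerProductSpace.rankOne ℂ (levelVec.{u} (star c))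
      (levelVec.{u} (star c))) (maxEntVec.{u, v} d) =
      tensorLeft (levelVec.{u} (star c)) (levelVec.{v} c) := by
    rw [maxEntVec, map_sum, levelVec_eq_sum.{v} c, map_sum]
    refine Finset.sum_congr rfl fun j _ => ?_
    rw [aliceHom_apply, opTensor_tensorLeft, InnerProductSpace.rankOne_apply, inner_levelVec,
      tensorLeft_smul, map_smul]
    simp [Pi.single_apply]
  have hr : bobHom _ _ (InnerProductSpace.rankOne ℂ (levelVec.{v} c) (levelVec.{v} c))
      (maxEntVec.{u, v} d) = tensorLeft (levelVec.{u} (star c)) (levelVec.{v} c) := by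
    rw [maxEntVec, map_sum, levelVec_eq_sum.{u} (star c), tensorLeft_sum]
    refine Finset.sum_congr rfl fun j _ => ?_
    rw [bobHom_apply, opTensor_tensorLeft, InnerProductSpace.rankOne_apply, inner_levelVec,
      tensorLeft_smul, map_smul]
    simp [Pi.single_apply]
  rw [hl, hr]

theorem norm_maxEntVec (d : ℕ) : ‖maxEntVec.{u, v} d‖ = √(d : ℝ) := by
  have h : ⟪maxEntVec.{u, v} d, maxEntVec.{u, v} d⟫_ℂ = d := by
    simp only [maxEntVec, sum_inner, inner_sum, inner_tensorLeft, inner_levelVec]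
    simp [Pi.single_apply]
  rw [norm_eq_sqrt_re_inner (𝕜 := ℂ), h]
  simp

/-- The discrete Fourier matrix has orthonormal rows. -/
theorem exists_fourier_matrix (hd : 0 < d) : ∃ U : Fin d → Fin d → ℂ,
    (∀ k l, ∑ j, starRingEnd ℂ (U k j) * U l j = if k = l then 1 else 0) ∧
      ∀ k j, starRingEnd ℂ (U k j) * U k j = 1 / d := by
  set ω := Complex.exp (2 * Real.pi * Complex.I / d) with hω
  have hprim : IsPrimitiveRoot ω d := Complex.isPrimitiveRoot_exp d hd.ne'
  have hdc : (d : ℂ) ≠ 0 := by exact_mod_cast hd.ne'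
  have hnorm : ‖ω‖ = 1 := hprim.norm'_eq_one hd.ne'
  have hconj : ∀ n : ℕ, starRingEnd ℂ (ω ^ n) = (ω ^ n)⁻¹ := fun n =>
    (Complex.inv_eq_conj (by rw [norm_pow, hnorm, one_pow])).symm
  have hω0 : ω ≠ 0 := hprim.ne_zero hd.ne'
  have hs : ((1 / √(d : ℝ) : ℝ) : ℂ) * ((1 / √(d : ℝ) : ℝ) : ℂ) = 1 / d := by
    rw [← Complex.ofReal_mul, div_mul_div_comm, one_mul, Real.mul_self_sqrt (by positivity)]
    simp
  have hterm : ∀ k l j : Fin d,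
      starRingEnd ℂ (((1 / √(d : ℝ) : ℝ) : ℂ) * ω ^ (k.1 * j.1)) *
        (((1 / √(d : ℝ) : ℝ) : ℂ) * ω ^ (l.1 * j.1)) = 1 / d * (ω ^ l.1 / ω ^ k.1) ^ j.1 := by
    intro k l j
    rw [map_mul, hconj, Complex.conj_ofReal, ← hs, div_pow, ← pow_mul, ← pow_mul]
    field_simp
  refine ⟨fun k j => ((1 / √(d : ℝ) : ℝ) : ℂ) * ω ^ (k.1 * j.1), fun k l => ?_, fun k j => ?_⟩
  · simp only [hterm]
    rw [← Finset.mul_sum, Fin.sum_univ_eq_sum_range (fun j => (ω ^ l.1 / ω ^ k.1) ^ j)]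
    split_ifs with hkl
    · subst hkl
      rw [div_self (pow_ne_zero _ hω0)]
      simp [hdc]
    · have hne : ω ^ l.1 / ω ^ k.1 ≠ 1 := by
        rw [Ne, div_eq_one_iff_eq (pow_ne_zero _ hω0)]
        intro h
        exact hkl (Fin.ext (hprim.pow_inj l.2 k.2 h).symm)
      have hpow : ∀ n : ℕ, (ω ^ n) ^ d = 1 := fun n => by
        rw [← pow_mul, mul_comm, pow_mul, hprim.pow_eq_one, one_pow]
      rw [geom_sum_eq hne, div_pow, hpow, hpow]
      simp
  · rw [hterm, div_self (pow_ne_zero _ hω0), one_pow, mul_one]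

theorem exists_optimal_realisation {t : ℝ} (ht : 0 < t) (htd : √(((d : ℝ) - 1) / d) = t)
    (hd : 1 < d) :
    ∃ R : Realisation d (EuclideanSpace ℂ (ULift.{u} (Fin d)))
      (EuclideanSpace ℂ (ULift.{v} (Fin d))), R.bellValue = ((d : ℝ) - 1) / t := by
  have hd0 : 0 < d := hd.le.trans_lt' one_pos
  obtain ⟨U, hU, hU1⟩ := exists_fourier_matrix hd0
  have hU' : ∀ k l, ∑ j, starRingEnd ℂ (star (U k) j) * star (U l) j =
      if k = l then 1 else 0 := by
    intro k l
    have h := congrArg (starRingEnd ℂ) (hU k l)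
    rw [map_sum, apply_ite (starRingEnd ℂ), map_one, map_zero] at h
    rw [← h]
    simp
  have h1 : ∀ k l : Fin d, ∑ j, starRingEnd ℂ ((Pi.single k 1 : Fin d → ℂ) j) *
      (Pi.single l 1 : Fin d → ℂ) j = if k = l then 1 else 0 := by
    intro k l
    simp [Pi.single_apply, eq_comm]
  obtain ⟨eA, heA⟩ := exists_basis_levelVec.{u} h1
  obtain ⟨eB, heB⟩ := exists_basis_levelVec.{v} h1
  obtain ⟨fA, hfA⟩ := exists_basis_levelVec.{u} hU'
  obtain ⟨fB, hfB⟩ := exists_basis_levelVec.{v} hU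
  have hs : (0 : ℝ) < √(d : ℝ) := Real.sqrt_pos.2 (by exact_mod_cast hd0)
  have hstar : ∀ j, star (Pi.single j 1 : Fin d → ℂ) = Pi.single j 1 := fun j => by
    ext i
    rw [Pi.star_apply, Pi.single_apply]
    split_ifs <;> simp
  refine exists_realisation_bellValue ht htd hd eA fA eB fB (fun j k => ?_)
    (Φ := ((1 / √(d : ℝ) : ℝ) : ℂ) • maxEntVec.{u, v} d) ?_ (fun j => ?_) (fun k => ?_)
  · rw [heA, hfA, inner_levelVec, inner_levelVec, ← hU1 k j]
    simp [Pi.single_apply]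
  · rw [norm_smul, norm_maxEntVec, Complex.norm_real, Real.norm_of_nonneg (by positivity),
      one_div_mul_cancel hs.ne']
  · have h := alice_rankOne_maxEntVec.{u, v} (Pi.single j 1 : Fin d → ℂ)
    rw [hstar] at h
    rw [heA, heB, map_smul, map_smul, h]
  · rw [hfA, hfB, map_smul, map_smul, alice_rankOne_maxEntVec]

end Fourier

end MUBBell

end

theorem theorem2 {d : ℕ} (hd : 2 ≤ d)
    {HA : Type u} [NormedAddCommGroup HA] [InnerProductSpace ℂ HA] [CompleteSpace HA]
    {HB : Type v} [NormedAddCommGroup HB] [InnerProductSpace ℂ HB] [CompleteSpace HB]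
    (R : MUBBell.Realisation d HA HB)
    (hmax : IsGreatest (MUBBell.quantumValues.{u, v} d) R.bellValue) :
    (∃ (VA : HA →ₗᵢ[ℂ] MUBBell.HTensor (EuclideanSpace ℂ (Fin d)) HA)
      (VB : HB →ₗᵢ[ℂ] MUBBell.HTensor (EuclideanSpace ℂ (Fin d)) HB)
      (ρaux : MUBBell.HTensor HA HB →L[ℂ] MUBBell.HTensor HA HB),
      MUBBell.IsDensityOperator ρaux ∧
      MUBBell.opTensor VA.toContinuousLinearMap VB.toContinuousLinearMap ∘L R.state ∘L
          (MUBBell.opTensor VA.toContinuousLinearMap VB.toContinuousLinearMap).adjoint =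
        MUBBell.adjoinMaxEnt d HA HB ∘L ρaux ∘L (MUBBell.adjoinMaxEnt d HA HB).adjoint) ∧
    (MUBBell.FullRank (MUBBell.marginalBob R.state) →
      (∀ y, (R.bob y).IsProjective) ∧
      ∀ a b : Fin d,
        (R.bob 0).effect a =
          (d : ℂ) • ((R.bob 0).effect a * (R.bob 1).effect b * (R.bob 0).effect a) ∧
        (R.bob 1).effect b =
          (d : ℂ) • ((R.bob 1).effect b * (R.bob 0).effect a * (R.bob 1).effect b)) := by
  have hd0 : 0 < d := by omega
  have hd1 : (2 : ℝ) ≤ d := by exact_mod_cast hd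
  have ht : 0 < √(((d : ℝ) - 1) / d) := Real.sqrt_pos.2 (div_pos (by linarith) (by linarith))
  generalize htd : √(((d : ℝ) - 1) / d) = t at ht
  have hR : ((d : ℝ) - 1) / t ≤ R.bellValue := by
    obtain ⟨R', hR'⟩ := MUBBell.exists_optimal_realisation.{u, v} ht htd hd
    exact hmax.2 ⟨_, _, _, _, _, _, _, _, R', hR'.symm⟩
  obtain ⟨EA, EB, pA, qA, hA, hB, hEA, hEB, hp, hq⟩ :=
    MUBBell.Realisation.exists_isMUBOn ht htd hd0 hR
  refine ⟨?_, fun hfull => ?_⟩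
  · set o : Fin d := ⟨0, hd0⟩
    obtain ⟨hρ, heq⟩ := MUBBell.isDensityOperator_comp_adjoint R.isDensity
      (MUBBell.adjoint_opTensor_comp_self (hA.adjoint_extraction_comp o)
        (hB.adjoint_extraction_comp o))
      (MUBBell.adjoint_adjoinMaxEnt_comp_self d HA HB hd0)
      (MUBBell.opTensor_extraction_mul hB hEA hEB hp hq o)
    exact ⟨hA.isometry o, hB.isometry o, _, hρ, heq⟩
  · have hE : EB = 1 := by
      have h1 : MUBBell.bobHom HA HB (1 - EB) * R.state = 0 := by
        rw [← R.isDensity.root_mul_root, ← mul_assoc, map_sub, map_one, sub_mul, one_mul, hEB,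
          sub_self, zero_mul]
      exact (sub_eq_zero.1 (MUBBell.eq_zero_of_fullRank_marginalBob hfull h1)).symm
    subst hE
    simp only [mul_one] at hB
    refine ⟨fun y => ?_, fun a b => ⟨(hB.unbiasedP a b).symm, (hB.unbiasedQ a b).symm⟩⟩
    fin_cases y
    · exact hB.projP
    · exact hB.projQ
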